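/- Let $S_1,\dots,S_m$ be non-degenerate (i.e. injective) contracting affine maps of the Euclidean plane $\mathbb R^2$ whose attractor (the unique nonempty compact set $\gamma$ with $\gamma=\bigcup_{i=1}^m S_i(\gamma)$) is a Jordan arc $\gamma$. If $\gamma$ is neither a segment of a parabola nor a straight line segment, then $\gamma$ is a component of the attractor of some self-affine Jordan multizipper $\mathcal Z$. Here a self-affine multizipper consists of a finite set $V$ of vertices and, for each $u\in V$, of nodes $x^{(u)}_0,\dots,x^{(u)}_{m_u}\in\mathbb R^2$ with $m_u\ge 1$ and, for each $k=1,\dots,m_u$, of a vertex $v=v(u,k)\in V$ and a non-degenerate contracting affine map $S^{(u)}_k$ of the plane that takes the pair $\bigl(x^{(v)}_0,x^{(v)}_{m_v}\bigr)$ either to $\bigl(x^{(u)}_{k-1},x^{(u)}_k\bigr)$ or to $\bigl(x^{(u)}_k,x^{(u)}_{k-1}\bigr)$. Its attractor is the unique family $(K_u)_{u\in V}$ of nonempty compact sets, called its components, such that $K_u=\bigcup_{k=1}^{m_u}S^{(u)}_k\bigl(K_{v(u,k)}\bigr)$ for all $u\in V$. It is a Jordan multizipper if every $K_u$ is a Jordan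 arc with endpoints $x^{(u)}_0$ and $x^{(u)}_{m_u}$, any two consecutive pieces $S^{(u)}_k\bigl(K_{v(u,k)}\bigr)$ and $S^{(u)}_{k+1}\bigl(K_{v(u,k+1)}\bigr)$ meet exactly in the point $x^{(u)}_k$, and non-consecutive pieces are disjoint. -/

import Mathlib

open scoped NNReal

/-- The Euclidean plane `ℝ²`. -/
abbrev Plane : Type := EuclideanSpace ℝ (Fin 2)

/-- `γ` is a Jordan arc with endpoints `a` and `b`: the image of `[0, 1]` under a continuous
injective map that sends `0` to `a` and `1` to `b`. -/
def IsJordanArcFrom (γ : Set Plane) (a b : Plane) : Prop :=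
  ∃ f : unitInterval → Plane,
    Continuous f ∧ Function.Injective f ∧ f 0 = a ∧ f 1 = b ∧ Set.range f = γ

/-- `γ` is a Jordan arc: a homeomorphic image of `[0, 1]`. -/
def IsJordanArc (γ : Set Plane) : Prop :=
  ∃ a b : Plane, IsJordanArcFrom γ a b

/-- `γ` is a (closed) straight line segment. -/
def IsStraightSegment (γ : Set Plane) : Prop :=
  ∃ a b : Plane, γ = segment ℝ a b

/-- `γ` is a closed bounded subarc of some parabola; the parabolas in the plane are the images of
the curve `y = x ^ 2` under the affine bijections of the plane. -/
def IsParabolicSegment (γ : Set Plane) : Prop :=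
  ∃ (T : Plane ≃ᵃ[ℝ] Plane) (s t : ℝ), s < t ∧
    γ = (fun x : ℝ => T !₂[x, x ^ 2]) '' Set.Icc s t

/-- A contracting affine map: Lipschitz with a constant `< 1` for the Euclidean metric. -/
def IsContractingAffine (f : Plane →ᵃ[ℝ] Plane) : Prop :=
  ∃ c : ℝ≥0, ContractingWith c f

/-- `A` is the attractor of the system `S`: the nonempty compact set with `A = ⋃ i, S i (A)`. -/
def IsAttractor {m : ℕ} (S : Fin m → Plane →ᵃ[ℝ] Plane) (A : Set Plane) : Prop :=
  A.Nonempty ∧ IsCompact A ∧ A = ⋃ i, S i '' A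

/-- A self-affine multizipper in the plane with set of vertices `Fin n`. To a vertex `u` belongs a
chain of nodes `x^u_0, …, x^u_(len u)`, and to its `k`-th link (from the `k`-th node to the next
one, `k` counted from `0`) belongs a non-degenerate contracting affine map, attached to a vertex
`v = target u k`, that takes the first and the last node of `v` to the two ends of the link, in
this order, or in the reverse order if `reversed u k` (the signature) is true. -/
structure SelfAffineMultizipper (n : ℕ) where
  len : Fin n → ℕ
  len_pos : ∀ u, 0 < len u
  node : ∀ u, Fin (len u + 1) → Plane
  target : ∀ u, Fin (len u) → Fin n
  reversed : ∀ u, Fin (len u) → Bool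
  map : ∀ u, Fin (len u) → Plane →ᵃ[ℝ] Plane
  map_injective : ∀ u k, Function.Injective (map u k)
  map_contracting : ∀ u k, IsContractingAffine (map u k)
  map_first : ∀ u k, map u k (node (target u k) 0) =
    node u (if reversed u k then k.succ else k.castSucc)
  map_last : ∀ u k, map u k (node (target u k) (Fin.last _)) =
    node u (if reversed u k then k.castSucc else k.succ)

namespace SelfAffineMultizipper

/-- The image of the component at `target u k` under the `k`-th map at the vertex `u`. -/
def piece {n : ℕ} (Z : SelfAffineMultizipper n) (K : Fin n → Set Plane) (u : Fin n)
    (k : Fin (Z.len u)) : Set Plane :=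
  Z.map u k '' K (Z.target u k)

/-- `K` is the attractor of the multizipper, i.e. of its graph-directed system of contractions:
the family of nonempty compact sets (the components) in which each one is the union of its
pieces. -/
def IsAttractor {n : ℕ} (Z : SelfAffineMultizipper n) (K : Fin n → Set Plane) : Prop :=
  ∀ u, (K u).Nonempty ∧ IsCompact (K u) ∧ K u = ⋃ k, Z.piece K u k

/-- The multizipper with attractor `K` is a Jordan multizipper: every component is a Jordan arc
from its first to its last node, two consecutive pieces of a component meet exactly in their
common node, and two pieces that are not consecutive are disjoint. -/
def IsJordan {n : ℕ} (Z : SelfAffineMultizipper n) (K : Fin n → Set Plane) : Prop :=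
  ∀ u, IsJordanArcFrom (K u) (Z.node u 0) (Z.node u (Fin.last _)) ∧
    (∀ i j : Fin (Z.len u), (i : ℕ) + 1 = j →
      Z.piece K u i ∩ Z.piece K u j = {Z.node u j.castSucc}) ∧
    (∀ i j : Fin (Z.len u), (i : ℕ) + 1 < j →
      Disjoint (Z.piece K u i) (Z.piece K u j))

end SelfAffineMultizipper

/-! Parametrise `γ` by `[0, 1]` and call an endpoint of some `S j '' γ` a cut point. It suffices to
find a finite Markov partition: a finite set `P` of parameters containing the ends, such that over
each gap of `P` the arc is the image under one `S i` of a subarc with ends in `P`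
(`exists_markov_partition`). All subarcs with ends in `P` are then the components of a multizipper
whose pieces are the gaps (`exists_multizipper`). Such a `P` consists of the cut points, their
preimages, and the orbits of these under an inverse `T` of the system that uses a single branch
between neighbouring cut points. What needs proof is that these orbits are finite.

The source of finiteness is a rigidity statement, `finite_mapsSubarc`. Were there infinitely many
affine maps between fixed subarcs, compactness would yield quotients different from the identity and
tending to it. Their rescaled displacements converge to a generator, and their iterates to a
one-parameter affine group with an orbit in `γ` (`exists_orbit_of_tendsto_one`). That orbit is
smooth and, as no subarc is collinear, curved. Some copy of `γ` lies in it, so the map making this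
copy has its fixed point on the orbit. Second-order comparison at this point shows that the linear
part has eigenvalues `α` and `α ^ 2`, and that `γ` lies on an invariant parabola
(`isParabolicSegment_of_orbit`).

Now let a copy `word S w '' γ` contain a cut point in its interior. A copy of comparable size with a
cut point sent to the same place (`exists_comparable_word`) gives a quotient map to which rigidity
applies, so away from the ends of `γ` only finitely many parameters are preimages of cut points. A
backward orbit that eventually stays near the ends of `γ` must land on them by contraction
(`finite_backward_orbit`). -/

namespace SelfAffineArc
open Set Filter Topology

/-! ### Parametrised arcs and words in the contractions -/

/-- `H` restricted to `[0, 1]` is a homeomorphism onto `γ` with inverse `τ`. -/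
structure IsParam (γ : Set Plane) (H : ℝ → Plane) (τ : Plane → ℝ) : Prop where
  cont : Continuous H
  contOn : ContinuousOn τ γ
  mem : ∀ t ∈ Icc (0 : ℝ) 1, H t ∈ γ
  inv_mem : ∀ x ∈ γ, τ x ∈ Icc (0 : ℝ) 1
  left_inv : ∀ t ∈ Icc (0 : ℝ) 1, τ (H t) = t
  right_inv : ∀ x ∈ γ, H (τ x) = x

/-- The maps `S i` are injective affine contractions with the common ratio `c`, and `γ` is the
union of its images under them. -/
structure IsSystem {m : ℕ} (S : Fin m → Plane →ᵃ[ℝ] Plane) (γ : Set Plane) (c : ℝ) : Prop where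
  nonneg : 0 ≤ c
  lt_one : c < 1
  dist_le : ∀ i x y, dist (S i x) (S i y) ≤ c * dist x y
  inj : ∀ i, Function.Injective (S i)
  eq_iUnion : γ = ⋃ i, S i '' γ

theorem exists_isParam {γ : Set Plane} (hγ : IsJordanArc γ) :
    ∃ H τ, IsParam γ H τ := by
  obtain ⟨a, b, f, hc, hi, -, -, rfl⟩ := hγ
  have hemb : IsClosedEmbedding f := hc.isClosedEmbedding hi
  let e := Equiv.ofInjective f hi
  let e' := hemb.isEmbedding.toHomeomorph
  -- `H` is constant on either side of `[0, 1]`, which keeps it continuous on the whole line; the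
  -- value `0` of `τ` off `γ` is never used.
  refine ⟨Set.IccExtend zero_le_one f,
    fun x => open Classical in if hx : x ∈ range f then (e'.symm ⟨x, hx⟩ : ℝ) else 0, ?_⟩
  have key : ∀ t : unitInterval, e'.symm ⟨f t, mem_range_self t⟩ = t := fun t =>
    e'.symm_apply_apply t
  refine ⟨hc.Icc_extend', ?_, ?_, ?_, ?_, ?_⟩
  · rw [continuousOn_iff_continuous_domRestrict]
    have : Continuous fun x : range f => ((e'.symm x : unitInterval) : ℝ) :=
      continuous_subtype_val.comp e'.symm.continuous
    convert this using 2 with x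
    simp
  · intro t ht
    rw [Set.IccExtend_of_mem _ _ ht]
    exact mem_range_self _
  · rintro x hx
    simp only [hx, dite_true]
    exact (e'.symm ⟨x, hx⟩).2
  · intro t ht
    rw [Set.IccExtend_of_mem _ _ ht]
    simp [key]
  · rintro x ⟨t, rfl⟩
    simp [key]

theorem exists_isSystem {m : ℕ} {S : Fin m → Plane →ᵃ[ℝ] Plane} {γ : Set Plane}
    (hc : ∀ i, IsContractingAffine (S i)) (hi : ∀ i, Function.Injective (S i))
    (hγ : IsAttractor S γ) : ∃ c, IsSystem S γ c := by
  choose k hk using hc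
  let K : ℝ≥0 := Finset.univ.sup k
  have hle : ∀ i, k i ≤ K := fun i => Finset.le_sup (Finset.mem_univ i)
  have hK : K < 1 := by
    rw [Finset.sup_lt_iff (by simp)]
    exact fun i _ => (hk i).1
  refine ⟨K, K.2, by exact_mod_cast hK, fun i x y => ?_, hi, hγ.2.2⟩
  calc dist (S i x) (S i y) ≤ k i * dist x y := (hk i).2.dist_le_mul x y
    _ ≤ K * dist x y := by gcongr; exact hle i

/-- The composition of the maps `S i` along a word. -/
noncomputable def word {m : ℕ} (S : Fin m → Plane →ᵃ[ℝ] Plane) : List (Fin m) → Plane →ᵃ[ℝ] Plane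
  | [] => AffineMap.id ℝ Plane
  | i :: w => (S i).comp (word S w)

section
variable {m : ℕ} {S : Fin m → Plane →ᵃ[ℝ] Plane} {γ : Set Plane} {c : ℝ}
  {H : ℝ → Plane} {τ : Plane → ℝ}

@[simp] theorem word_nil (x : Plane) : word S [] x = x := rfl

@[simp] theorem word_cons (i : Fin m) (w : List (Fin m)) (x : Plane) :
    word S (i :: w) x = S i (word S w x) := rfl

theorem word_append (u w : List (Fin m)) (x : Plane) :
    word S (u ++ w) x = word S u (word S w x) := by
  induction u with
  | nil => rfl
  | cons i u ih => simp [ih]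

namespace IsSystem

theorem map_mem (hS : IsSystem S γ c) (i : Fin m) {x : Plane} (hx : x ∈ γ) : S i x ∈ γ := by
  rw [hS.eq_iUnion]
  exact mem_iUnion_of_mem i (mem_image_of_mem _ hx)

theorem exists_map_eq (hS : IsSystem S γ c) {x : Plane} (hx : x ∈ γ) :
    ∃ i, ∃ y ∈ γ, S i y = x := by
  rw [hS.eq_iUnion] at hx
  simpa using hx

theorem word_mem (hS : IsSystem S γ c) (w : List (Fin m)) {x : Plane} (hx : x ∈ γ) :
    word S w x ∈ γ := by
  induction w with
  | nil => exact hx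
  | cons i w ih => exact hS.map_mem i ih

theorem word_injective (hS : IsSystem S γ c) (w : List (Fin m)) :
    Function.Injective (word S w) := by
  induction w with
  | nil => exact fun _ _ h => h
  | cons i w ih => exact (hS.inj i).comp ih

theorem dist_word_le (hS : IsSystem S γ c) (w : List (Fin m)) (x y : Plane) :
    dist (word S w x) (word S w y) ≤ c ^ w.length * dist x y := by
  induction w with
  | nil => simp
  | cons i w ih =>
    calc dist (S i (word S w x)) (S i (word S w y))
        ≤ c * dist (word S w x) (word S w y) := hS.dist_le i _ _
      _ ≤ c * (c ^ w.length * dist x y) := by gcongr; exact hS.nonneg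
      _ = c ^ (i :: w).length * dist x y := by rw [List.length_cons]; ring

theorem exists_word_eq (hS : IsSystem S γ c) (k : ℕ) {x : Plane} (hx : x ∈ γ) :
    ∃ w : List (Fin m), w.length = k ∧ ∃ y ∈ γ, word S w y = x := by
  induction k generalizing x with
  | zero => exact ⟨[], rfl, x, hx, rfl⟩
  | succ k ih =>
    obtain ⟨i, y, hy, rfl⟩ := hS.exists_map_eq hx
    obtain ⟨w, hw, z, hz, rfl⟩ := ih hy
    exact ⟨i :: w, by simp [hw], z, hz, rfl⟩

theorem exists_pow_mul_lt (hS : IsSystem S γ c) (D : ℝ) {r : ℝ} (hr : 0 < r) :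
    ∃ k : ℕ, 0 < k ∧ c ^ k * D < r := by
  have h : Tendsto (fun k : ℕ => c ^ k * D) atTop (𝓝 (0 * D)) :=
    (tendsto_pow_atTop_nhds_zero_of_lt_one hS.nonneg hS.lt_one).mul_const D
  rw [zero_mul] at h
  obtain ⟨k, hk, hk'⟩ := ((h.eventually (gt_mem_nhds hr)).and (eventually_gt_atTop 0)).exists
  exact ⟨k, hk', hk⟩

end IsSystem

namespace IsParam

theorem injOn (hp : IsParam γ H τ) {s t : ℝ} (hs : s ∈ Icc (0 : ℝ) 1) (ht : t ∈ Icc (0 : ℝ) 1)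
    (h : H s = H t) : s = t := by
  rw [← hp.left_inv s hs, h, hp.left_inv t ht]

theorem image_eq (hp : IsParam γ H τ) : H '' Icc 0 1 = γ := by
  ext x
  constructor
  · rintro ⟨t, ht, rfl⟩
    exact hp.mem t ht
  · exact fun hx => ⟨τ x, hp.inv_mem x hx, hp.right_inv x hx⟩

theorem isCompact (hp : IsParam γ H τ) : IsCompact γ := by
  rw [← hp.image_eq]
  exact isCompact_Icc.image hp.cont

theorem isConnected (hp : IsParam γ H τ) : IsConnected γ := by
  rw [← hp.image_eq]
  exact (isConnected_Icc zero_le_one).image _ hp.cont.continuousOn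

theorem exists_dist_le (hp : IsParam γ H τ) : ∃ D, 0 < D ∧ ∀ x ∈ γ, ∀ y ∈ γ, dist x y ≤ D := by
  obtain ⟨D, hD⟩ := Metric.isBounded_iff.1 hp.isCompact.isBounded
  exact ⟨max D 1, by positivity, fun x hx y hy => (hD hx hy).trans (le_max_left _ _)⟩

/-- Points of `γ` close to `H t` have parameters close to `t`. -/
theorem exists_ball (hp : IsParam γ H τ) {a b t : ℝ} (ht : t ∈ Icc (0 : ℝ) 1) (ha : a < t)
    (hb : t < b) : ∃ r > 0, ∀ y ∈ γ, dist y (H t) < r → τ y ∈ Ioo a b := by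
  have h := hp.contOn (H t) (hp.mem t ht)
  have h2 : τ ⁻¹' Ioo a b ∈ 𝓝[γ] (H t) := h (by
    rw [hp.left_inv t ht]; exact Ioo_mem_nhds ha hb)
  obtain ⟨r, hr, hr'⟩ := Metric.mem_nhdsWithin_iff.1 h2
  exact ⟨r, hr, fun y hy hd => hr' ⟨hd, hy⟩⟩

/-- Every point of `γ` lies in a copy of each level, and the diameters of the copies tend to `0`.
This passes properties of the whole arc to each of its subarcs, and puts fixed points into
prescribed subarcs. -/
theorem exists_small_copy (hp : IsParam γ H τ) (hS : IsSystem S γ c) {a b : ℝ} (ha : 0 ≤ a)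
    (hab : a < b) (hb : b ≤ 1) :
    ∃ w : List (Fin m), w ≠ [] ∧ ∀ x ∈ γ, τ (word S w x) ∈ Ioo a b := by
  obtain ⟨t, hat, htb⟩ := exists_between hab
  have ht : t ∈ Icc (0 : ℝ) 1 := ⟨ha.trans hat.le, htb.le.trans hb⟩
  obtain ⟨r, hr, hball⟩ := hp.exists_ball ht hat htb
  obtain ⟨D, -, hD⟩ := hp.exists_dist_le
  obtain ⟨k, hk, hkr⟩ := hS.exists_pow_mul_lt D hr
  obtain ⟨w, rfl, y, hy, hwy⟩ := hS.exists_word_eq k (hp.mem t ht)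
  refine ⟨w, by rintro rfl; simp at hk, fun x hx => hball _ (hS.word_mem w hx) ?_⟩
  rw [← hwy]
  refine lt_of_le_of_lt ((hS.dist_word_le w x y).trans ?_) hkr
  exact mul_le_mul_of_nonneg_left (hD x hx y hy) (pow_nonneg hS.nonneg _)

end IsParam

theorem image_Icc_of_injOn {ψ : ℝ → ℝ} {a b : ℝ} (hab : a ≤ b) (hc : ContinuousOn ψ (Icc a b))
    (hi : InjOn ψ (Icc a b)) : ψ '' Icc a b = uIcc (ψ a) (ψ b) := by
  rcases hc.strictMonoOn_of_injOn_Icc' hab hi with h | h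
  · have hle : ψ a ≤ ψ b := h.monotoneOn (left_mem_Icc.2 hab) (right_mem_Icc.2 hab) hab
    rw [uIcc_of_le hle]
    refine Subset.antisymm ?_ (intermediate_value_Icc hab hc)
    rintro _ ⟨t, ht, rfl⟩
    exact ⟨h.monotoneOn (left_mem_Icc.2 hab) ht ht.1, h.monotoneOn ht (right_mem_Icc.2 hab) ht.2⟩
  · have hle : ψ b ≤ ψ a := h.antitoneOn (left_mem_Icc.2 hab) (right_mem_Icc.2 hab) hab
    rw [uIcc_of_ge hle]
    refine Subset.antisymm ?_ (intermediate_value_Icc' hab hc)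
    rintro _ ⟨t, ht, rfl⟩
    exact ⟨h.antitoneOn ht (right_mem_Icc.2 hab) ht.2, h.antitoneOn (left_mem_Icc.2 hab) ht ht.1⟩

/-- An injective continuous map that takes a subarc into the arc takes it onto the subarc between
the images of the endpoints. -/
theorem IsParam.image_uIcc (hp : IsParam γ H τ) {f : Plane → Plane} (hf : Continuous f)
    (hfi : Function.Injective f) {a b : ℝ} (ha : a ∈ Icc (0 : ℝ) 1) (hb : b ∈ Icc (0 : ℝ) 1)
    (h : ∀ t ∈ uIcc a b, f (H t) ∈ γ) :
    f '' (H '' uIcc a b) = H '' uIcc (τ (f (H a))) (τ (f (H b))) := by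
  wlog hab : a ≤ b generalizing a b
  · rw [uIcc_comm a b, uIcc_comm (τ _)]
    exact this hb ha (by rwa [uIcc_comm]) (le_of_not_ge hab)
  rw [uIcc_of_le hab] at h ⊢
  have hsub : Icc a b ⊆ Icc 0 1 := Icc_subset_Icc ha.1 hb.2
  have h1 : ContinuousOn (fun t => τ (f (H t))) (Icc a b) :=
    hp.contOn.comp (hf.comp hp.cont).continuousOn h
  have h2 : InjOn (fun t => τ (f (H t))) (Icc a b) := by
    intro s hs t ht hst
    have := congrArg H hst
    simp only [hp.right_inv _ (h s hs), hp.right_inv _ (h t ht)] at this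
    exact hp.injOn (hsub hs) (hsub ht) (hfi this)
  have h3 : (fun t => τ (f (H t))) '' Icc a b = uIcc (τ (f (H a))) (τ (f (H b))) :=
    image_Icc_of_injOn hab h1 h2
  rw [← h3, image_image, image_image]
  exact image_congr fun t ht => (hp.right_inv _ (h t ht)).symm

end

/-! ### Homogeneous coordinates and collinearity -/

/-- Homogeneous coordinates: the plane as the affine plane `{(x, 1)}` in a linear space. -/
def hat (x : Plane) : Plane × ℝ := (x, 1)

theorem continuous_hat : Continuous hat := by unfold hat; fun_prop

theorem hat_injective : Function.Injective hat := fun _ _ h => congrArg Prod.fst h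

/-- The linear map on homogeneous coordinates induced by an affine map. -/
noncomputable def lift (f : Plane →ᵃ[ℝ] Plane) : (Plane × ℝ) →L[ℝ] (Plane × ℝ) :=
  LinearMap.toContinuousLinearMap
    ((f.linear.coprod (LinearMap.toSpanSingleton ℝ Plane (f 0))).prod (LinearMap.snd ℝ Plane ℝ))

theorem lift_apply (f : Plane →ᵃ[ℝ] Plane) (v : Plane × ℝ) :
    lift f v = (f.linear v.1 + v.2 • f 0, v.2) := by
  simp [lift]

theorem lift_hat (f : Plane →ᵃ[ℝ] Plane) (x : Plane) : lift f (hat x) = hat (f x) := by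
  rw [lift_apply]
  have h := f.map_vadd 0 x
  simp only [vadd_eq_add, add_zero] at h
  simp [hat, h]

theorem lift_injective {f : Plane →ᵃ[ℝ] Plane} (hf : Function.Injective f) :
    Function.Injective (lift f) := by
  rintro ⟨x, s⟩ ⟨y, t⟩ h
  simp only [lift_apply, Prod.mk.injEq] at h
  obtain ⟨h, rfl⟩ := h
  rw [add_left_inj] at h
  rw [f.linear_injective_iff.2 hf h]

theorem exists_inverse_lift {f : Plane →ᵃ[ℝ] Plane} (hf : Function.Injective f) :
    ∃ M : (Plane × ℝ) →L[ℝ] (Plane × ℝ), M * lift f = 1 ∧ lift f * M = 1 := by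
  let e := LinearEquiv.ofInjectiveEndo (lift f : (Plane × ℝ) →ₗ[ℝ] (Plane × ℝ)) (lift_injective hf)
  refine ⟨LinearMap.toContinuousLinearMap (e.symm : (Plane × ℝ) →ₗ[ℝ] (Plane × ℝ)), ?_, ?_⟩
  · refine ContinuousLinearMap.ext fun v => ?_
    change e.symm (e v) = v
    simp
  · refine ContinuousLinearMap.ext fun v => ?_
    change e (e.symm v) = v
    simp

theorem isStraightSegment_of_line {γ : Set Plane} (hc : IsCompact γ) (hn : IsConnected γ)
    {x₀ d : Plane} {g : Plane → ℝ} (hg : Continuous g) (h : ∀ x ∈ γ, x = x₀ + g x • d) :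
    IsStraightSegment γ := by
  obtain ⟨s, t, hst, hI⟩ : ∃ s t, s ≤ t ∧ g '' γ = Icc s t :=
    ⟨_, _, by
      have h1 := hn.image g hg.continuousOn
      have := h1.nonempty
      rw [eq_Icc_of_connected_compact h1 (hc.image hg)] at this
      exact nonempty_Icc.1 this,
      eq_Icc_of_connected_compact (hn.image g hg.continuousOn) (hc.image hg)⟩
  let L : ℝ →ᵃ[ℝ] Plane := AffineMap.lineMap x₀ (x₀ + d)
  have hL : ∀ u, L u = x₀ + u • d := by
    intro u
    simp [L, AffineMap.lineMap_apply, add_comm]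
  refine ⟨L s, L t, ?_⟩
  rw [← image_segment, segment_eq_Icc hst, ← hI, image_image]
  ext x
  constructor
  · intro hx
    exact ⟨x, hx, (hL _).trans (h x hx).symm⟩
  · rintro ⟨y, hy, rfl⟩
    have : L (g y) = y := (hL _).trans (h y hy).symm
    simpa only [this] using hy

/-- A nonzero functional vanishing on `hat '' γ` is the equation of a line through `γ`; its linear
part cannot vanish, since `γ` is nonempty. -/
theorem span_eq_top_of_not_isStraightSegment {γ : Set Plane} (hc : IsCompact γ)
    (hn : IsConnected γ) (h : ¬ IsStraightSegment γ) :
    Submodule.span ℝ (hat '' γ) = ⊤ := by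
  by_contra hne
  obtain ⟨φ, hφ, hle⟩ := Submodule.exists_le_ker_of_lt_top _ (lt_top_iff_ne_top.2 hne)
  have hker : ∀ x ∈ γ, φ (hat x) = 0 := fun x hx =>
    hle (Submodule.subset_span (mem_image_of_mem _ hx))
  set α := φ (EuclideanSpace.single 0 1, 0) with hα
  set β := φ (EuclideanSpace.single 1 1, 0) with hβ
  set κ := φ (0, 1) with hκ
  have hform : ∀ (x : Plane) (s : ℝ), φ (x, s) = x 0 * α + x 1 * β + s * κ := by
    intro x s
    have : (x, s) = x 0 • ((EuclideanSpace.single 0 1 : Plane), (0 : ℝ)) +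
        x 1 • ((EuclideanSpace.single 1 1 : Plane), (0 : ℝ)) + s • ((0 : Plane), (1 : ℝ)) := by
      ext i
      · fin_cases i <;> simp
      · simp
    rw [this]
    simp only [map_add, map_smul, smul_eq_mul, α, β, κ]
  obtain ⟨x₀, hx₀⟩ := hn.nonempty
  have h0 := hker x₀ hx₀
  rw [hat, hform] at h0
  have hne : α ^ 2 + β ^ 2 ≠ 0 := by
    intro h
    have h1 : α = 0 := by nlinarith
    have h2 : β = 0 := by nlinarith
    have h3 : κ = 0 := by simpa [h1, h2] using h0
    apply hφ
    refine LinearMap.ext fun v => ?_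
    rw [show v = (v.1, v.2) from rfl, hform]
    simp [h1, h2, h3]
  -- The direction is the normal `(α, β)` turned by a right angle, and `g` is the coordinate of the
  -- orthogonal projection to the line.
  refine h (isStraightSegment_of_line hc hn (x₀ := x₀) (d := !₂[-β, α])
    (g := fun x => (-β * (x 0 - x₀ 0) + α * (x 1 - x₀ 1)) / (α ^ 2 + β ^ 2)) (by fun_prop) ?_)
  intro x hx
  have h1 := hker x hx
  rw [hat, hform] at h1
  ext i
  fin_cases i
  · simp
    field_simp
    linear_combination (-α) * h0 + α * h1
  · simp
    field_simp
    linear_combination (-β) * h0 + β * h1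

section
variable {m : ℕ} {S : Fin m → Plane →ᵃ[ℝ] Plane} {γ : Set Plane} {c : ℝ}
  {H : ℝ → Plane} {τ : Plane → ℝ}

/-- A subarc contains an affine copy of `γ`, and the lift of a nondegenerate affine map is a linear
bijection. -/
theorem IsParam.span_subarc (hp : IsParam γ H τ) (hS : IsSystem S γ c)
    (h : ¬ IsStraightSegment γ) {a b : ℝ} (ha : 0 ≤ a) (hab : a < b) (hb : b ≤ 1) :
    Submodule.span ℝ (hat '' (H '' Icc a b)) = ⊤ := by
  obtain ⟨w, -, hw⟩ := hp.exists_small_copy hS ha hab hb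
  have hsub : lift (word S w) '' (hat '' γ) ⊆ hat '' (H '' Icc a b) := by
    rintro _ ⟨_, ⟨x, hx, rfl⟩, rfl⟩
    rw [lift_hat]
    refine mem_image_of_mem _ ⟨_, Ioo_subset_Icc_self (hw x hx), ?_⟩
    exact hp.right_inv _ (hS.word_mem w hx)
  rw [eq_top_iff]
  refine le_trans ?_ (Submodule.span_mono hsub)
  have h1 := Submodule.map_span (lift (word S w) : (Plane × ℝ) →ₗ[ℝ] (Plane × ℝ)) (hat '' γ)
  rw [span_eq_top_of_not_isStraightSegment hp.isCompact hp.isConnected h, Submodule.map_top,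
    LinearMap.range_eq_top.2
      (LinearMap.injective_iff_surjective.1 (lift_injective (hS.word_injective w)))] at h1
  exact h1.le

end

/-! ### Powers of operators near the identity -/

section
variable {𝔸 : Type*} [NormedRing 𝔸] [NormOneClass 𝔸]

theorem norm_pow_sub_pow_le {a b : 𝔸} {M : ℝ} (hM : 1 ≤ M) (ha : ‖a‖ ≤ M) (hb : ‖b‖ ≤ M) (k : ℕ) :
    ‖a ^ k - b ^ k‖ ≤ k * M ^ k * ‖a - b‖ := by
  induction k with
  | zero => simp
  | succ k ih =>
    have h : a ^ (k + 1) - b ^ (k + 1) = a ^ k * (a - b) + (a ^ k - b ^ k) * b := by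
      rw [pow_succ, pow_succ]; noncomm_ring
    have hak : ‖a ^ k‖ ≤ M ^ k := (norm_pow_le a k).trans (pow_le_pow_left₀ (norm_nonneg _) ha k)
    rw [h]
    calc ‖a ^ k * (a - b) + (a ^ k - b ^ k) * b‖
        ≤ ‖a ^ k‖ * ‖a - b‖ + ‖a ^ k - b ^ k‖ * ‖b‖ :=
          (norm_add_le _ _).trans (add_le_add (norm_mul_le _ _) (norm_mul_le _ _))
      _ ≤ M ^ k * ‖a - b‖ + k * M ^ k * ‖a - b‖ * M := by gcongr
      _ ≤ M ^ k * M * ‖a - b‖ + k * M ^ k * ‖a - b‖ * M := by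
          gcongr
          exact le_mul_of_one_le_right (by positivity) hM
      _ = (k + 1 : ℕ) * M ^ (k + 1) * ‖a - b‖ := by push_cast; ring

theorem norm_exp_le_exp_norm [NormedAlgebra ℝ 𝔸] [CompleteSpace 𝔸] (x : 𝔸) :
    ‖NormedSpace.exp x‖ ≤ Real.exp ‖x‖ := by
  have h1 := NormedSpace.exp_series_hasSum_exp' (𝕂 := ℝ) x
  have h2 := NormedSpace.exp_series_hasSum_exp' (𝕂 := ℝ) ‖x‖
  rw [← Real.exp_eq_exp_ℝ] at h2
  refine h1.norm_le_of_bounded h2 fun n => ?_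
  rw [norm_smul, smul_eq_mul, norm_inv, RCLike.norm_natCast]
  gcongr
  exact norm_pow_le x n

/-- Let `k = ⌊s / ε⌋₊`, so that `k * ε → s` and `exp (ε • B) ^ k = exp ((k * ε) • B)` has the
asserted limit. Replacing `exp (ε • B)` by `g` is an error `o(ε)`, which the `k`-th power magnifies
at most by the factor `k * exp (k * ε)`, of order `1 / ε`. -/
theorem tendsto_pow_floor_exp [NormedAlgebra ℝ 𝔸] [CompleteSpace 𝔸] {g B : ℕ → 𝔸} {ε : ℕ → ℝ}
    {A : 𝔸} (hε : ∀ n, 0 < ε n) (hε0 : Tendsto ε atTop (𝓝 0)) (hB : ∀ n, ‖B n‖ ≤ 1)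
    (hg : ∀ n, g n = 1 + ε n • B n) (hA : Tendsto B atTop (𝓝 A)) {s : ℝ} (hs : 0 ≤ s) :
    Tendsto (fun n => g n ^ ⌊s / ε n⌋₊) atTop (𝓝 (NormedSpace.exp (s • A))) := by
  let _ : NormedAlgebra ℚ 𝔸 := NormedAlgebra.restrictScalars ℚ ℝ 𝔸
  have hk : Tendsto (fun n => (⌊s / ε n⌋₊ : ℝ) * ε n) atTop (𝓝 s) := by
    refine tendsto_of_tendsto_of_tendsto_of_le_of_le (g := fun n => s - ε n) (h := fun _ => s)
      (by simpa using tendsto_const_nhds.sub hε0) tendsto_const_nhds (fun n => ?_) (fun n => ?_)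
    · have h := (Nat.lt_floor_add_one (s / ε n)).le
      rw [div_le_iff₀ (hε n)] at h
      simp only
      linarith
    · have h := Nat.floor_le (div_nonneg hs (hε n).le)
      rwa [le_div_iff₀ (hε n)] at h
  have h1 : Tendsto (fun n => NormedSpace.exp (ε n • B n) ^ ⌊s / ε n⌋₊) atTop
      (𝓝 (NormedSpace.exp (s • A))) := by
    have : Tendsto (fun n => NormedSpace.exp (((⌊s / ε n⌋₊ : ℝ) * ε n) • B n)) atTop
        (𝓝 (NormedSpace.exp (s • A))) :=
      ((NormedSpace.exp_continuous (𝔸 := 𝔸)).tendsto _).comp (hk.smul hA)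
    refine this.congr fun n => ?_
    rw [mul_smul, Nat.cast_smul_eq_nsmul, NormedSpace.exp_nsmul]
  have h2 : Tendsto (fun n => (ε n)⁻¹ * ‖g n - NormedSpace.exp (ε n • B n)‖) atTop (𝓝 0) := by
    have hd := (hasFDerivAt_exp_zero (𝕂 := ℝ) (𝔸 := 𝔸)).isLittleO
    have ht : Tendsto (fun n => ε n • B n) atTop (𝓝 0) := by
      simpa using hε0.smul hA
    have h3 := (hd.comp_tendsto ht)
    rw [← Asymptotics.isLittleO_norm_left] at h3
    have h4 : (fun n => ‖g n - NormedSpace.exp (ε n • B n)‖) =o[atTop] ε := by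
      refine (Asymptotics.IsLittleO.trans_isBigO ?_ (g := fun n => ε n • B n) ?_)
      · refine h3.congr' ?_ ?_
        · filter_upwards with n
          simp only [Function.comp, sub_zero, NormedSpace.exp_zero, hg]
          rw [← norm_neg]
          congr 1
          simp
          abel
        · filter_upwards with n
          simp
      · refine Asymptotics.IsBigO.of_bound 1 ?_
        filter_upwards with n
        rw [norm_smul, one_mul]
        exact mul_le_of_le_one_right (norm_nonneg _) (hB n)
    have h5 := h4.tendsto_div_nhds_zero
    refine h5.congr fun n => ?_
    rw [div_eq_inv_mul]
  have h3 : Tendsto (fun n => g n ^ ⌊s / ε n⌋₊ - NormedSpace.exp (ε n • B n) ^ ⌊s / ε n⌋₊) atTop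
      (𝓝 0) := by
    have hlim := (tendsto_const_nhds (x := s * Real.exp s)).mul h2
    rw [mul_zero] at hlim
    refine squeeze_zero_norm (fun n => ?_) hlim
    have hn1 : ‖ε n • B n‖ ≤ ε n := by
      rw [norm_smul, Real.norm_of_nonneg (hε n).le]
      exact mul_le_of_le_one_right (hε n).le (hB n)
    have hg1 : ‖g n‖ ≤ Real.exp (ε n) := by
      rw [hg]
      refine (norm_add_le _ _).trans ?_
      rw [norm_one]
      linarith [Real.add_one_le_exp (ε n)]
    have he1 : ‖NormedSpace.exp (ε n • B n)‖ ≤ Real.exp (ε n) :=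
      (norm_exp_le_exp_norm _).trans (Real.exp_le_exp.2 hn1)
    have hf := Nat.floor_le (div_nonneg hs (hε n).le)
    have hf2 := hf
    rw [le_div_iff₀ (hε n)] at hf2
    refine (norm_pow_sub_pow_le (Real.one_le_exp (hε n).le) hg1 he1 _).trans ?_
    rw [← Real.exp_nat_mul]
    calc (⌊s / ε n⌋₊ : ℝ) * Real.exp (⌊s / ε n⌋₊ * ε n) * ‖g n - NormedSpace.exp (ε n • B n)‖
        ≤ (s / ε n) * Real.exp s * ‖g n - NormedSpace.exp (ε n • B n)‖ := by
          have := div_nonneg hs (hε n).le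
          gcongr
      _ = s * Real.exp s * ((ε n)⁻¹ * ‖g n - NormedSpace.exp (ε n • B n)‖) := by
        rw [div_eq_mul_inv]; ring
  have h6 := h3.add h1
  rw [zero_add] at h6
  exact h6.congr fun n => by abel

end

/-! ### From maps near the identity to a one-parameter group -/

section
variable {m : ℕ} {S : Fin m → Plane →ᵃ[ℝ] Plane} {γ : Set Plane} {c : ℝ}
  {H : ℝ → Plane} {τ : Plane → ℝ}

/-- A sequence of linear maps that tends to the identity and takes a subarc into the arc gives rise
to a one-parameter group one of whose orbits runs along the arc. -/
theorem exists_orbit_of_tendsto_one (hp : IsParam γ H τ)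
    (hspan : ∀ a b, 0 ≤ a → a < b → b ≤ 1 → Submodule.span ℝ (hat '' (H '' Icc a b)) = ⊤)
    {g : ℕ → (Plane × ℝ) →L[ℝ] (Plane × ℝ)} (hg1 : Tendsto g atTop (𝓝 1)) (hne : ∀ n, g n ≠ 1)
    {a b : ℝ} (ha : 0 ≤ a) (hab : a < b) (hb : b ≤ 1)
    (hg : ∀ n, ∀ t ∈ Icc a b, ∃ y ∈ γ, g n (hat (H t)) = hat y) :
    ∃ A : (Plane × ℝ) →L[ℝ] (Plane × ℝ), (∀ v, (A v).2 = 0) ∧ ∃ x ∈ γ, A (hat x) ≠ 0 ∧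
      ∃ s₀ : ℝ, 0 < s₀ ∧ ∀ s ∈ Icc 0 s₀, ∃ y ∈ γ, NormedSpace.exp (s • A) (hat x) = hat y := by
  have hpos : ∀ n, 0 < ‖g n - 1‖ := fun n => norm_pos_iff.2 (sub_ne_zero.2 (hne n))
  have hlim0 : Tendsto (fun n => ‖g n - 1‖) atTop (𝓝 0) := by
    simpa using (hg1.sub_const 1).norm
  let B : ℕ → (Plane × ℝ) →L[ℝ] (Plane × ℝ) := fun n => ‖g n - 1‖⁻¹ • (g n - 1)
  have hB1 : ∀ n, ‖B n‖ = 1 := fun n => by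
    simp only [B, norm_smul, norm_inv, norm_norm]
    exact inv_mul_cancel₀ (hpos n).ne'
  obtain ⟨A, hA, φ, hφ, hBA⟩ := (isCompact_sphere (0 : (Plane × ℝ) →L[ℝ] (Plane × ℝ)) 1).tendsto_subseq
    (x := B) (fun n => by simp [hB1])
  have hA0 : A ≠ 0 := by
    rintro rfl
    simp at hA
  -- The lifted points of the subarc span the space, so each `g n` comes from an affine map; in the
  -- limit `A` is an affine vector field.
  have hsnd : ∀ n v, (g n v).2 = v.2 := by
    intro n v
    have hv : v ∈ Submodule.span ℝ (hat '' (H '' Icc a b)) := by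
      rw [hspan a b ha hab hb]; trivial
    induction hv using Submodule.span_induction with
    | mem x hx =>
      obtain ⟨_, ⟨t, ht, rfl⟩, rfl⟩ := hx
      obtain ⟨y, -, hy⟩ := hg n t ht
      rw [hy]
      rfl
    | zero => simp
    | add x y _ _ hx hy => simp [hx, hy]
    | smul r x _ hx => simp [hx]
  have hA2 : ∀ v, (A v).2 = 0 := by
    intro v
    have h1 : Tendsto (fun n => (B (φ n) v).2) atTop (𝓝 (A v).2) :=
      (continuous_snd.tendsto _).comp
        (((ContinuousLinearMap.apply ℝ (Plane × ℝ) v).continuous.tendsto A).comp hBA)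
    refine tendsto_nhds_unique h1 (tendsto_const_nhds.congr fun n => ?_)
    simp [B, hsnd]
  -- The starting point is taken strictly inside `[a, b]`, which leaves room for many iterates
  -- before they leave the subarc on which `g n` is controlled.
  obtain ⟨a', haa', ha'b⟩ := exists_between hab
  obtain ⟨b', hab', hb'b⟩ := exists_between ha'b
  obtain ⟨t, ht, htA⟩ : ∃ t ∈ Icc a' b', A (hat (H t)) ≠ 0 := by
    by_contra! hcon
    apply hA0
    have hle : Submodule.span ℝ (hat '' (H '' Icc a' b')) ≤ (A : (Plane × ℝ) →ₗ[ℝ] (Plane × ℝ)).ker := by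
      rw [Submodule.span_le]
      rintro _ ⟨_, ⟨t, ht, rfl⟩, rfl⟩
      exact hcon t ht
    rw [hspan a' b' (by linarith) hab' (by linarith)] at hle
    refine ContinuousLinearMap.ext fun v => ?_
    exact hle (Submodule.mem_top (x := v))
  have ht01 : t ∈ Icc (0 : ℝ) 1 := ⟨by linarith [ht.1], by linarith [ht.2]⟩
  refine ⟨A, hA2, H t, hp.mem t ht01, htA, ?_⟩
  obtain ⟨r, hr, hball⟩ := hp.exists_ball ht01 (show a < t by linarith [ht.1])
    (show t < b by linarith [ht.2])
  -- `R` bounds the lifted points within distance `r` of `H t`, so one application of `g n` moves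
  -- such a point by at most `‖g n - 1‖ * R`.
  set R := ‖hat (H t)‖ + r with hR
  have hRpos : 0 < R := by positivity
  have hiter : ∀ n (k : ℕ), k * ‖g n - 1‖ * R < r →
      ∃ y ∈ γ, (g n ^ k) (hat (H t)) = hat y ∧ dist y (H t) ≤ k * ‖g n - 1‖ * R := by
    intro n k
    induction k with
    | zero => exact fun _ => ⟨H t, hp.mem t ht01, by simp, by simp⟩
    | succ k ih =>
      intro hk
      push_cast at hk
      have hp0 : 0 < ‖g n - 1‖ * R := mul_pos (hpos n) hRpos
      obtain ⟨y, hy, hgy, hd⟩ := ih (by nlinarith)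
      have hdr : dist y (H t) < r := by nlinarith
      obtain ⟨z, hz, hgz⟩ := hg n (τ y) (Ioo_subset_Icc_self (hball y hy hdr))
      rw [hp.right_inv y hy] at hgz
      refine ⟨z, hz, by rw [pow_succ', mul_apply_eq_comp, hgy, hgz], ?_⟩
      have hdh : ∀ p q : Plane, dist p q = ‖hat p - hat q‖ := fun p q => by
        simp [hat, dist_eq_norm, Prod.norm_def]
      have hy2 : ‖hat y‖ ≤ R := by
        have h1 := norm_sub_norm_le (hat y) (hat (H t))
        rw [← hdh] at h1
        linarith
      have hzy : dist z y ≤ ‖g n - 1‖ * R := by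
        rw [hdh, ← hgz]
        have h1 : g n (hat y) - hat y = (g n - 1) (hat y) := by simp
        rw [h1]
        exact ((g n - 1).le_opNorm _).trans (by gcongr)
      push_cast
      linarith [dist_triangle z y (H t)]
  -- Up to this time the `⌊s / ‖g n - 1‖⌋₊` iterations move the point by at most `r / 2` in total.
  refine ⟨r / (2 * R), by positivity, fun s hs => ?_⟩
  have hlim := tendsto_pow_floor_exp (g := g ∘ φ) (B := B ∘ φ) (ε := fun n => ‖g (φ n) - 1‖)
    (fun n => hpos _) (hlim0.comp hφ.tendsto_atTop) (fun n => (hB1 _).le) (fun n => by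
      simp only [Function.comp, B]
      rw [smul_inv_smul₀ (hpos _).ne']
      abel) hBA hs.1
  have hlim2 := (((ContinuousLinearMap.apply ℝ (Plane × ℝ) (hat (H t))).continuous.tendsto _).comp
    hlim)
  have hclosed : IsClosed (hat '' γ) := (hp.isCompact.image continuous_hat).isClosed
  have hmem := hclosed.mem_of_tendsto hlim2 (Eventually.of_forall fun n => by
    have hf := Nat.floor_le (div_nonneg hs.1 (hpos (φ n)).le)
    rw [le_div_iff₀ (hpos _)] at hf
    obtain ⟨y, hy, hgy, -⟩ := hiter (φ n) ⌊s / ‖g (φ n) - 1‖⌋₊ (by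
      have h2 : s * R ≤ r / (2 * R) * R := by gcongr; exact hs.2
      have h3 : r / (2 * R) * R = r / 2 := by field_simp
      nlinarith)
    exact ⟨y, hy, hgy.symm⟩)
  obtain ⟨y, hy, h⟩ := hmem
  exact ⟨y, hy, h.symm⟩

end

/-! ### An affine map with its fixed point on a curved arc -/

/-- Here `ℓ` and `n` are the tangential and the transversal coordinate of the iterates. As `n` is of
order `ℓ ^ 2`, dividing its recursion by `ℓ k` forces `β = 0`, and then dividing by `ℓ k ^ 2`
compares `δ` with the squared ratio `ℓ (k + 1) / ℓ k → α`. -/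
theorem coeff_eq_of_tendsto {ℓ n : ℕ → ℝ} {α β κ δ : ℝ} (hne : ∀ᶠ k in atTop, ℓ k ≠ 0)
    (h0 : Tendsto ℓ atTop (𝓝 0)) (hq : Tendsto (fun k => n k / ℓ k ^ 2) atTop (𝓝 (1 / 2)))
    (hℓ : ∀ k, ℓ (k + 1) = α * ℓ k + κ * n k) (hn : ∀ k, n (k + 1) = β * ℓ k + δ * n k) :
    β = 0 ∧ δ = α ^ 2 := by
  have hne1 : ∀ᶠ k in atTop, ℓ (k + 1) ≠ 0 := (tendsto_add_atTop_nat 1).eventually hne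
  have hq1 : Tendsto (fun k => n (k + 1) / ℓ (k + 1) ^ 2) atTop (𝓝 (1 / 2)) :=
    hq.comp (tendsto_add_atTop_nat 1)
  have hr : Tendsto (fun k => n k / ℓ k) atTop (𝓝 0) := by
    have h := hq.mul h0
    rw [mul_zero] at h
    refine h.congr' ?_
    filter_upwards [hne] with k hk
    field_simp
  have hr1 : Tendsto (fun k => n (k + 1) / ℓ (k + 1)) atTop (𝓝 0) :=
    hr.comp (tendsto_add_atTop_nat 1)
  have hα : Tendsto (fun k => ℓ (k + 1) / ℓ k) atTop (𝓝 α) := by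
    have h := (hr.const_mul κ).const_add α
    rw [mul_zero, add_zero] at h
    refine h.congr' ?_
    filter_upwards [hne] with k hk
    rw [hℓ]
    field_simp
  have hβ : β = 0 := by
    have h := (hr.const_mul δ).const_add β
    rw [mul_zero, add_zero] at h
    have h' := hr1.mul hα
    rw [zero_mul] at h'
    refine tendsto_nhds_unique (h.congr' ?_) h'
    filter_upwards [hne, hne1] with k hk hk1
    rw [div_mul_div_cancel₀ hk1, hn]
    field_simp
  refine ⟨hβ, ?_⟩
  subst hβ
  have h := hq.const_mul δ
  have h' := hq1.mul (hα.pow 2)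
  have := tendsto_nhds_unique (h.congr' ?_) h'
  · linarith
  · filter_upwards [hne, hne1] with k hk hk1
    rw [div_pow, div_mul_div_cancel₀ (pow_ne_zero 2 hk1), hn]
    field_simp
    ring

/-- By the choice of `θ`, one step multiplies `ℓ + θ * n` by `α` and `n` by `α ^ 2`. Hence `n / (ℓ +
θ * n) ^ 2` is constant along the sequence and equals its limit: an asymptotic relation at the fixed
point becomes exact at the starting point. -/
theorem eq_half_sq_of_tendsto {ℓ n : ℕ → ℝ} {α κ θ : ℝ} (hne : ∀ᶠ k in atTop, ℓ k ≠ 0)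
    (h0 : Tendsto ℓ atTop (𝓝 0)) (hq : Tendsto (fun k => n k / ℓ k ^ 2) atTop (𝓝 (1 / 2)))
    (hℓ : ∀ k, ℓ (k + 1) = α * ℓ k + κ * n k) (hn : ∀ k, n (k + 1) = α ^ 2 * n k)
    (hθ : κ + θ * α ^ 2 = α * θ) :
    n 0 = 1 / 2 * (ℓ 0 + θ * n 0) ^ 2 := by
  have hr : Tendsto (fun k => n k / ℓ k) atTop (𝓝 0) := by
    have h := hq.mul h0
    rw [mul_zero] at h
    refine h.congr' ?_
    filter_upwards [hne] with k hk
    field_simp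
  have h1 : Tendsto (fun k => (ℓ k + θ * n k) / ℓ k) atTop (𝓝 1) := by
    have h := (hr.const_mul θ).const_add 1
    rw [mul_zero, add_zero] at h
    refine h.congr' ?_
    filter_upwards [hne] with k hk
    field_simp
  have hq' : Tendsto (fun k => n k / (ℓ k + θ * n k) ^ 2) atTop (𝓝 (1 / 2)) := by
    have h := hq.div (h1.pow 2) (by norm_num)
    rw [one_pow, div_one] at h
    refine h.congr' ?_
    filter_upwards [hne] with k hk
    simp only [Pi.div_apply]
    rw [div_pow, div_div_div_cancel_right₀ (pow_ne_zero 2 hk)]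
  have hne' : ∀ᶠ k in atTop, ℓ k + θ * n k ≠ 0 := by
    filter_upwards [h1.eventually_ne one_ne_zero] with k hk h
    simp [h] at hk
  have hpow : ∀ k, ℓ k + θ * n k = α ^ k * (ℓ 0 + θ * n 0) ∧ n k = (α ^ k) ^ 2 * n 0 := by
    intro k
    induction k with
    | zero => simp
    | succ k ih =>
      refine ⟨?_, ?_⟩
      · rw [hℓ, hn, pow_succ']
        linear_combination α * ih.1 + n k * hθ
      · rw [hn, pow_succ']
        linear_combination α ^ 2 * ih.2
  have h := hq'.mul_const ((ℓ 0 + θ * n 0) ^ 2)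
  refine tendsto_nhds_unique (tendsto_const_nhds.congr' ?_) h
  filter_upwards [hne'] with k hk
  have h2 : α ^ k ≠ 0 := by
    intro h3
    apply hk
    rw [(hpow k).1, h3, zero_mul]
  have h3 : ℓ 0 + θ * n 0 ≠ 0 := by
    intro h3
    apply hk
    rw [(hpow k).1, h3, mul_zero]
  rw [(hpow k).1, (hpow k).2, mul_pow, mul_div_mul_left _ _ (pow_ne_zero 2 h2),
    div_mul_cancel₀ _ (pow_ne_zero 2 h3)]

theorem tendsto_div_sq {L N N' : ℝ → ℝ} {s₀ : ℝ} (hL : HasDerivAt L 1 s₀) (hL0 : L s₀ = 0)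
    (hN : ∀ s, HasDerivAt N (N' s) s) (hN0 : N s₀ = 0) (hN'0 : N' s₀ = 0)
    (hN' : HasDerivAt N' 1 s₀) :
    Tendsto (fun s => N s / L s ^ 2) (𝓝[≠] s₀) (𝓝 (1 / 2)) := by
  have h1 : Tendsto (fun s => L s / (s - s₀)) (𝓝[≠] s₀) (𝓝 1) := by
    have h := hasDerivAt_iff_tendsto_slope.1 hL
    refine h.congr fun s => ?_
    simp [slope_def_field, hL0]
  have h2 : Tendsto (fun s => N' s / (2 * (s - s₀))) (𝓝[≠] s₀) (𝓝 (1 / 2)) := by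
    have h := (hasDerivAt_iff_tendsto_slope.1 hN').const_mul (1 / 2)
    rw [mul_one] at h
    refine h.congr fun s => ?_
    rw [slope_def_field, hN'0, sub_zero, div_mul_div_comm, one_mul]
  have h3 : Tendsto (fun s => N s / (s - s₀) ^ 2) (𝓝[≠] s₀) (𝓝 (1 / 2)) := by
    refine HasDerivAt.lhopital_zero_nhdsNE (g' := fun s => 2 * (s - s₀))
      (Eventually.of_forall hN) (Eventually.of_forall fun s => ?_) ?_ ?_ ?_ h2
    · have := ((hasDerivAt_id' s).sub_const s₀).fun_pow 2
      simpa using this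
    · filter_upwards [self_mem_nhdsWithin] with s hs
      exact mul_ne_zero two_ne_zero (sub_ne_zero.2 hs)
    · have := (hN s₀).continuousAt.tendsto
      rw [hN0] at this
      exact this.mono_left nhdsWithin_le_nhds
    · have : Tendsto (fun s => (s - s₀) ^ 2) (𝓝 s₀) (𝓝 ((s₀ - s₀) ^ 2)) :=
        (continuous_id.sub continuous_const).pow 2 |>.tendsto s₀
      rw [sub_self, zero_pow two_ne_zero] at this
      exact this.mono_left nhdsWithin_le_nhds
  have h4 := h3.div (h1.pow 2) (by norm_num)
  rw [one_pow, div_one] at h4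
  refine h4.congr' ?_
  filter_upwards [self_mem_nhdsWithin] with s hs
  have : s - s₀ ≠ 0 := sub_ne_zero.2 hs
  simp only [Pi.div_apply]
  rw [div_pow, div_div_div_cancel_right₀ (pow_ne_zero 2 this)]

/-- A set that is invariant under an affine map, and runs near the fixed point along a curve of
nonzero curvature, lies on a parabola. -/
theorem exists_parabola_coords {f : Plane →ᵃ[ℝ] Plane} (hf : Function.Injective f) {p : Plane}
    (hfp : f p = p) (hfix : ∀ q, f q = q → q = p) {γ : Set Plane} (hγ : ∃ y ∈ γ, y ≠ p)
    {c v : ℝ → Plane} {a : Plane} {s₀ : ℝ} (hcp : c s₀ = p) (hc : ∀ s, HasDerivAt c (v s) s)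
    (hv : HasDerivAt v a s₀) (hli : LinearIndependent ℝ ![v s₀, a])
    (hseq : ∀ y ∈ γ, y ≠ p → ∃ s : ℕ → ℝ, Tendsto s atTop (𝓝 s₀) ∧ (∀ k, s k ≠ s₀) ∧
      ∀ k, f^[k + 1] y = c (s k)) :
    ∃ (e₁ e₂ : Plane) (r : Plane → ℝ), LinearIndependent ℝ ![e₁, e₂] ∧ Continuous r ∧
      ∀ y ∈ γ, y = p + (r y • e₁ + r y ^ 2 • e₂) := by
  let b := basisOfLinearIndependentOfCardEqFinrank hli (by simp)
  have hb0 : b 0 = v s₀ := by simp [b]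
  have hb1 : b 1 = a := by simp [b]
  let ℓ : Plane →L[ℝ] ℝ := LinearMap.toContinuousLinearMap (b.coord 0)
  let n : Plane →L[ℝ] ℝ := LinearMap.toContinuousLinearMap (b.coord 1)
  have hℓv : ℓ (v s₀) = 1 := by rw [← hb0]; simp [ℓ]
  have hnv : n (v s₀) = 0 := by rw [← hb0]; simp [n]
  have hna : n a = 1 := by rw [← hb1]; simp [n]
  have hdec : ∀ z, z = ℓ z • v s₀ + n z • a := by
    intro z
    have := b.sum_repr z
    rw [Fin.sum_univ_two, hb0, hb1] at this
    exact this.symm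
  have hflin : ∀ z, f z - p = f.linear (z - p) := by
    intro z
    have := f.linearMap_vsub z p
    rw [hfp] at this
    simpa using this.symm
  have hℓf : ∀ z, ℓ (f z - p) = ℓ (f.linear (v s₀)) * ℓ (z - p) + ℓ (f.linear a) * n (z - p) := by
    intro z
    rw [hflin]
    conv_lhs => rw [hdec (z - p)]
    simp only [map_add, map_smul, smul_eq_mul]
    ring
  have hnf : ∀ z, n (f z - p) = n (f.linear (v s₀)) * ℓ (z - p) + n (f.linear a) * n (z - p) := by
    intro z
    rw [hflin]
    conv_lhs => rw [hdec (z - p)]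
    simp only [map_add, map_smul, smul_eq_mul]
    ring
  have hL : ∀ s, HasDerivAt (fun s => ℓ (c s - p)) (ℓ (v s)) s := fun s =>
    ℓ.hasFDerivAt.comp_hasDerivAt s ((hc s).sub_const p)
  have hN : ∀ s, HasDerivAt (fun s => n (c s - p)) (n (v s)) s := fun s =>
    n.hasFDerivAt.comp_hasDerivAt s ((hc s).sub_const p)
  have hN' : HasDerivAt (fun s => n (v s)) 1 s₀ := by
    have := n.hasFDerivAt.comp_hasDerivAt s₀ hv
    rw [hna] at this
    exact this
  have hlim := tendsto_div_sq (hℓv ▸ hL s₀) (by simp [hcp]) hN (by simp [hcp]) hnv hN'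
  have hLne : ∀ᶠ s in 𝓝[≠] s₀, ℓ (c s - p) ≠ 0 :=
    (hL s₀).eventually_ne (by rw [hℓv]; exact one_ne_zero)
  have hL0 : Tendsto (fun s => ℓ (c s - p)) (𝓝[≠] s₀) (𝓝 0) := by
    have := (hL s₀).continuousAt.tendsto
    simp only [hcp, sub_self, map_zero] at this
    exact this.mono_left nhdsWithin_le_nhds
  have hall : ∀ y ∈ γ, y ≠ p → (∀ᶠ k in atTop, ℓ (f^[k] y - p) ≠ 0) ∧
      Tendsto (fun k => ℓ (f^[k] y - p)) atTop (𝓝 0) ∧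
      Tendsto (fun k => n (f^[k] y - p) / ℓ (f^[k] y - p) ^ 2) atTop (𝓝 (1 / 2)) := by
    intro y hy hyp
    obtain ⟨s, hs, hsne, hsc⟩ := hseq y hy hyp
    have hs' : Tendsto s atTop (𝓝[≠] s₀) :=
      tendsto_nhdsWithin_iff.2 ⟨hs, Eventually.of_forall hsne⟩
    refine ⟨?_, ?_, ?_⟩
    · have h : Tendsto (fun k => k - 1) atTop atTop := tendsto_sub_atTop_nat 1
      filter_upwards [h.eventually (hs'.eventually hLne), eventually_ge_atTop 1] with k hk hk1
      rwa [← hsc, Nat.sub_add_cancel hk1] at hk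
    · rw [← tendsto_add_atTop_iff_nat 1]
      simp only [hsc]
      exact hL0.comp hs'
    · rw [← tendsto_add_atTop_iff_nat 1]
      simp only [hsc]
      exact hlim.comp hs'
  obtain ⟨hβ, hδ⟩ : n (f.linear (v s₀)) = 0 ∧ n (f.linear a) = ℓ (f.linear (v s₀)) ^ 2 := by
    obtain ⟨y, hy, hyp⟩ := hγ
    obtain ⟨h1, h2, h3⟩ := hall y hy hyp
    exact coeff_eq_of_tendsto h1 h2 h3
      (fun k => by rw [Function.iterate_succ_apply']; exact hℓf _)
      (fun k => by rw [Function.iterate_succ_apply']; exact hnf _)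
  have hfv : f.linear (v s₀) = ℓ (f.linear (v s₀)) • v s₀ := by
    have := hdec (f.linear (v s₀))
    rwa [hβ, zero_smul, add_zero] at this
  set α := ℓ (f.linear (v s₀)) with hα
  set κ := ℓ (f.linear a) with hκ
  have hv0 : v s₀ ≠ 0 := fun h => by simp [h] at hℓv
  have hα0 : α ≠ 0 := by
    intro h
    rw [h, zero_smul] at hfv
    exact hv0 ((f.linear_injective_iff.2 hf) (by rw [hfv, map_zero]))
  have hα1 : α ≠ 1 := by
    intro h
    rw [h, one_smul] at hfv
    have h1 := hflin (p + v s₀)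
    rw [add_sub_cancel_left, hfv, sub_eq_iff_eq_add'] at h1
    exact hv0 (by simpa using hfix _ h1)
  have hαα : α - α ^ 2 ≠ 0 := by
    have : α - α ^ 2 = α * (1 - α) := by ring
    rw [this]
    exact mul_ne_zero hα0 (sub_ne_zero.2 hα1.symm)
  -- This shear diagonalises the linear part. The denominator is nonzero because `f` is injective
  -- (`α ≠ 0`) and has only one fixed point (`α ≠ 1`).
  let θ := κ / (α - α ^ 2)
  have hθ : κ + θ * α ^ 2 = α * θ := by
    simp only [θ]
    field_simp
    ring
  refine ⟨v s₀, (1 / 2 : ℝ) • (a - θ • v s₀), fun y => ℓ (y - p) + θ * n (y - p), ?_, by fun_prop, ?_⟩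
  · rw [LinearIndependent.pair_iff] at hli ⊢
    intro s t hst
    obtain ⟨h1, h2⟩ := hli (s - t * (1 / 2) * θ) (t * (1 / 2)) (by
      rw [← hst]; module)
    have h3 : t = 0 := by linarith
    subst h3
    exact ⟨by linarith, rfl⟩
  · intro y hy
    have key : n (y - p) = 1 / 2 * (ℓ (y - p) + θ * n (y - p)) ^ 2 := by
      by_cases hyp : y = p
      · simp [hyp]
      · obtain ⟨h1, h2, h3⟩ := hall y hy hyp
        exact eq_half_sq_of_tendsto h1 h2 h3
          (fun k => by rw [Function.iterate_succ_apply']; exact hℓf _)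
          (fun k => by
            rw [Function.iterate_succ_apply']
            have := hnf (f^[k] y)
            rwa [hβ, hδ, zero_mul, zero_add] at this) hθ
    have h4 := hdec (y - p)
    rw [sub_eq_iff_eq_add'] at h4
    simp only
    conv_lhs => rw [h4]
    rw [smul_smul, show (ℓ (y - p) + θ * n (y - p)) ^ 2 * (1 / 2) = n (y - p) by linarith]
    module

theorem isParabolicSegment_of_coords {γ : Set Plane} (hcp : IsCompact γ) (hcn : IsConnected γ)
    (hnt : γ.Nontrivial) {p e₁ e₂ : Plane} (hli : LinearIndependent ℝ ![e₁, e₂]) {r : Plane → ℝ}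
    (hr : Continuous r) (h : ∀ y ∈ γ, y = p + (r y • e₁ + r y ^ 2 • e₂)) :
    IsParabolicSegment γ := by
  let b := basisOfLinearIndependentOfCardEqFinrank hli (by simp)
  have hb0 : b 0 = e₁ := by simp [b]
  have hb1 : b 1 = e₂ := by simp [b]
  let L : Plane ≃ₗ[ℝ] Plane := (WithLp.linearEquiv 2 ℝ (Fin 2 → ℝ)).trans b.equivFun.symm
  let T : Plane ≃ᵃ[ℝ] Plane := L.toAffineEquiv.trans (AffineEquiv.constVAdd ℝ Plane p)
  have hT : ∀ x y : ℝ, T !₂[x, y] = p + (x • e₁ + y • e₂) := by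
    intro x y
    simp [T, L, Module.Basis.equivFun_symm_apply, hb0, hb1]
  have hI := eq_Icc_of_connected_compact (hcn.image r hr.continuousOn) (hcp.image hr)
  refine ⟨T, sInf (r '' γ), sSup (r '' γ), ?_, ?_⟩
  · obtain ⟨y, hy, z, hz, hyz⟩ := hnt
    have hy' := hI ▸ mem_image_of_mem r hy
    have hz' := hI ▸ mem_image_of_mem r hz
    by_contra hle
    apply hyz
    rw [h y hy, h z hz, show r y = r z by
      linarith [hy'.1, hy'.2, hz'.1, hz'.2, not_lt.1 hle]]
  · rw [← hI, image_image]
    simp only [hT]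
    ext y
    constructor
    · exact fun hy => ⟨y, hy, (h y hy).symm⟩
    · rintro ⟨z, hz, rfl⟩
      simpa only [← h z hz] using hz

/-! ### Arcs that contain an orbit of a one-parameter group -/

theorem tendsto_of_tendsto_comp_of_injOn {X Y : Type*} [TopologicalSpace X] [TopologicalSpace Y]
    [T2Space Y] {K : Set X} (hK : IsCompact K) {c : X → Y} (hc : ContinuousOn c K)
    (hi : InjOn c K) {s : ℕ → X} {s₀ : X} (hs : ∀ k, s k ∈ K) (hs₀ : s₀ ∈ K)
    (h : Tendsto (fun k => c (s k)) atTop (𝓝 (c s₀))) : Tendsto s atTop (𝓝 s₀) := by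
  have : CompactSpace K := isCompact_iff_compactSpace.1 hK
  have hemb : IsClosedEmbedding (K.domRestrict c) :=
    (continuousOn_iff_continuous_domRestrict.1 hc).isClosedEmbedding (injOn_iff_injective.1 hi)
  have h1 : Tendsto (fun k => (⟨s k, hs k⟩ : K)) atTop (𝓝 ⟨s₀, hs₀⟩) := by
    rw [hemb.isInducing.tendsto_nhds_iff]
    exact h
  exact (continuous_subtype_val.tendsto _).comp h1

/-- For a short time the projection to the initial velocity is strictly increasing. -/
theorem exists_injOn_of_hasDerivAt {c v : ℝ → Plane} (hc : ∀ s, HasDerivAt c (v s) s)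
    (hv : Continuous v) (hv0 : v 0 ≠ 0) {s₀ : ℝ} (hs₀ : 0 < s₀) :
    ∃ s₁, 0 < s₁ ∧ s₁ ≤ s₀ ∧ InjOn c (Icc 0 s₁) := by
  let ℓ : Plane →L[ℝ] ℝ := innerSL ℝ (v 0)
  have hℓ : ∀ s, HasDerivAt (fun s => ℓ (c s)) (ℓ (v s)) s := fun s =>
    ℓ.hasFDerivAt.comp_hasDerivAt s (hc s)
  have hpos : 0 < ℓ (v 0) := by
    simp only [ℓ, innerSL_apply_apply]
    exact real_inner_self_pos.2 hv0
  have hev : ∀ᶠ s in 𝓝 0, 0 < ℓ (v s) :=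
    ((ℓ.continuous.comp hv).tendsto 0).eventually (lt_mem_nhds hpos)
  obtain ⟨r, hr, hball⟩ := Metric.eventually_nhds_iff.1 hev
  refine ⟨min s₀ (r / 2), by positivity, min_le_left _ _, ?_⟩
  have hmono : StrictMonoOn (fun s => ℓ (c s)) (Icc 0 (min s₀ (r / 2))) := by
    refine strictMonoOn_of_deriv_pos (convex_Icc _ _)
      (fun s _ => (hℓ s).continuousAt.continuousWithinAt) fun s hs => ?_
    rw [interior_Icc] at hs
    rw [(hℓ s).deriv]
    apply hball
    rw [Real.dist_eq, sub_zero, abs_of_pos hs.1]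
    linarith [hs.2, min_le_right s₀ (r / 2)]
  intro s hs t ht hst
  exact hmono.injOn hs ht (congrArg ℓ hst)

section
variable {m : ℕ} {S : Fin m → Plane →ᵃ[ℝ] Plane} {γ : Set Plane} {c : ℝ}
  {H : ℝ → Plane} {τ : Plane → ℝ}

theorem IsSystem.exists_fixedPoint (hS : IsSystem S γ c) (hγ : IsCompact γ) (hne : γ.Nonempty)
    {w : List (Fin m)} (hw : w ≠ []) :
    ∃ p ∈ γ, word S w p = p ∧ (∀ q, word S w q = q → q = p) ∧
      ∀ y, Tendsto (fun k => (word S w)^[k] y) atTop (𝓝 p) := by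
  have hpow : c ^ w.length < 1 :=
    pow_lt_one₀ hS.nonneg hS.lt_one (by simpa using hw)
  let K : ℝ≥0 := ⟨c ^ w.length, pow_nonneg hS.nonneg _⟩
  have hC : ContractingWith K (word S w) :=
    ⟨(NNReal.coe_lt_coe (r₁ := K) (r₂ := 1)).1 hpow,
      LipschitzWith.of_dist_le_mul fun x y => hS.dist_word_le w x y⟩
  have hlim := hC.tendsto_iterate_fixedPoint
  obtain ⟨y, hy⟩ := hne
  refine ⟨hC.fixedPoint, ?_, hC.fixedPoint_isFixedPt, fun q hq => hC.fixedPoint_unique hq, hlim⟩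
  refine hγ.isClosed.mem_of_tendsto (hlim y) (Eventually.of_forall fun k => ?_)
  induction k with
  | zero => exact hy
  | succ k ih =>
    rw [Function.iterate_succ_apply']
    exact hS.word_mem w ih

/-- A self-affine arc along which an orbit of a one-parameter group of affine maps runs is a
parabolic segment, if its subarcs are not collinear. -/
theorem isParabolicSegment_of_orbit (hp : IsParam γ H τ) (hS : IsSystem S γ c)
    (hspan : ∀ a b, 0 ≤ a → a < b → b ≤ 1 → Submodule.span ℝ (hat '' (H '' Icc a b)) = ⊤)
    {A : (Plane × ℝ) →L[ℝ] (Plane × ℝ)} (hA : ∀ v, (A v).2 = 0) {x : Plane}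
    (hAx : A (hat x) ≠ 0) {s₀ : ℝ} (hs₀ : 0 < s₀)
    (horb : ∀ s ∈ Icc 0 s₀, ∃ y ∈ γ, NormedSpace.exp (s • A) (hat x) = hat y) :
    IsParabolicSegment γ := by
  let E : ℝ → (Plane × ℝ) →L[ℝ] (Plane × ℝ) := fun s => NormedSpace.exp (s • A)
  have hE : ∀ s, HasDerivAt E (E s * A) s := fun s => hasDerivAt_exp_smul_const A s
  have hEv : ∀ (u : Plane × ℝ) s, HasDerivAt (fun s => E s u) (E s (A u)) s := fun u s =>
    (ContinuousLinearMap.apply ℝ (Plane × ℝ) u).hasFDerivAt.comp_hasDerivAt s (hE s)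
  have hE1 : ∀ (u : Plane × ℝ) s, HasDerivAt (fun s => (E s u).1) (E s (A u)).1 s := fun u s =>
    (ContinuousLinearMap.fst ℝ Plane ℝ).hasFDerivAt.comp_hasDerivAt s (hEv u s)
  have hcomm : ∀ s, A * E s = E s * A := fun s =>
    (hasDerivAt_exp_smul_const' A s).unique (hE s)
  have hE2 : ∀ (u : Plane × ℝ) s, (E s (A u)).2 = 0 := fun u s => by
    have := congrArg (fun M : (Plane × ℝ) →L[ℝ] (Plane × ℝ) => M u) (hcomm s)
    simp only [mul_apply_eq_comp] at this
    rw [← this, hA]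
  have hE0 : E 0 = 1 := by
    have h : (0 : ℝ) • A = 0 := ContinuousLinearMap.ext fun u => zero_smul ℝ (A u)
    exact (congrArg NormedSpace.exp h).trans NormedSpace.exp_zero
  have hEinj : ∀ s, Function.Injective (E s) := by
    intro s
    let _ : NormedAlgebra ℚ ((Plane × ℝ) →L[ℝ] (Plane × ℝ)) := NormedAlgebra.restrictScalars ℚ ℝ _
    obtain ⟨U, hU⟩ := NormedSpace.isUnit_exp (s • A)
    intro u₁ u₂ h
    have h1 : ∀ u, (U⁻¹).val (E s u) = u := fun u => by
      have := congrArg (fun M : (Plane × ℝ) →L[ℝ] (Plane × ℝ) => M u) U.inv_mul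
      simpa [hU] using this
    rw [← h1 u₁, h, h1]
  let σ : ℝ → Plane := fun s => (E s (hat x)).1
  let v : ℝ → Plane := fun s => (E s (A (hat x))).1
  let a : ℝ → Plane := fun s => (E s (A (A (hat x)))).1
  have hσ : ∀ s, HasDerivAt σ (v s) s := hE1 _
  have hv : ∀ s, HasDerivAt v (a s) s := hE1 _
  have hσγ : ∀ s ∈ Icc 0 s₀, σ s ∈ γ := by
    intro s hs
    obtain ⟨y, hy, h⟩ := horb s hs
    simp only [σ, E, h]
    exact hy
  have hv0 : v 0 ≠ 0 := by
    intro h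
    refine hAx (Prod.ext ?_ (hA _))
    simpa [v, hE0] using h
  obtain ⟨s₁, hs₁, hs₁₀, hinj⟩ := exists_injOn_of_hasDerivAt hσ
    (continuous_iff_continuousAt.2 fun s => (hv s).continuousAt) hv0 hs₀
  have hσγ1 : ∀ s ∈ Icc 0 s₁, σ s ∈ γ := fun s hs => hσγ s ⟨hs.1, hs.2.trans hs₁₀⟩
  have hσc : Continuous σ := continuous_iff_continuousAt.2 fun s => (hσ s).continuousAt
  -- the orbit contains a subarc
  obtain ⟨α, β, hα, hαβ, hβ, hsub⟩ : ∃ α β, 0 ≤ α ∧ α < β ∧ β ≤ 1 ∧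
      ∀ t ∈ Icc α β, ∃ s ∈ Icc 0 s₁, σ s = H t := by
    have h0 : (0 : ℝ) ∈ Icc 0 s₁ := ⟨le_rfl, hs₁.le⟩
    have h1 : s₁ ∈ Icc 0 s₁ := ⟨hs₁.le, le_rfl⟩
    have hne : τ (σ 0) ≠ τ (σ s₁) := by
      intro h
      have := congrArg H h
      rw [hp.right_inv _ (hσγ1 0 h0), hp.right_inv _ (hσγ1 _ h1)] at this
      exact hs₁.ne (hinj h0 h1 this)
    have hi0 := hp.inv_mem _ (hσγ1 0 h0)
    have hi1 := hp.inv_mem _ (hσγ1 _ h1)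
    refine ⟨min (τ (σ 0)) (τ (σ s₁)), max (τ (σ 0)) (τ (σ s₁)), le_min hi0.1 hi1.1,
      min_lt_max.2 hne, max_le hi0.2 hi1.2, fun t ht => ?_⟩
    have hcon : ContinuousOn (fun s => τ (σ s)) (uIcc 0 s₁) := by
      rw [uIcc_of_le hs₁.le]
      exact hp.contOn.comp hσc.continuousOn hσγ1
    obtain ⟨s, hs, rfl⟩ := intermediate_value_uIcc hcon ht
    rw [uIcc_of_le hs₁.le] at hs
    exact ⟨s, hs, (hp.right_inv _ (hσγ1 s hs)).symm⟩
  -- If the acceleration is a multiple of the velocity at time `0`, it is the same multiple at all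
  -- times. The velocity then keeps its direction, the orbit is straight, and the subarc inside it
  -- would be collinear.
  by_cases hli : LinearIndependent ℝ ![v 0, a 0]
  swap
  · exfalso
    rw [LinearIndependent.pair_iff' hv0] at hli
    push Not at hli
    obtain ⟨μ, hμ⟩ := hli
    have hμA : A (A (hat x)) = μ • A (hat x) := by
      refine Prod.ext ?_ (by simp [hA])
      simpa [v, a, hE0] using hμ.symm
    have hav : ∀ s, a s = μ • v s := fun s => by simp [a, v, hμA]
    let d : ℝ → Plane := fun s => Real.exp (-μ * s) • v s
    have hd : ∀ s, HasDerivAt d 0 s := by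
      intro s
      have h1 : HasDerivAt (fun s => Real.exp (-μ * s)) (Real.exp (-μ * s) * -μ) s := by
        have := ((hasDerivAt_id' s).const_mul (-μ)).exp
        simpa using this
      refine (h1.fun_smul (hv s)).congr_deriv ?_
      rw [hav]
      module
    have hdc : ∀ s, v s = Real.exp (μ * s) • v 0 := by
      intro s
      have h1 := is_const_of_deriv_eq_zero (fun s => (hd s).differentiableAt)
        (fun s => (hd s).deriv) s 0
      simp only [d, mul_zero, Real.exp_zero, one_smul] at h1
      rw [← h1, smul_smul, ← Real.exp_add]
      simp
    let φ : Plane →L[ℝ] ℝ := (v 0 0) • EuclideanSpace.proj 1 - (v 0 1) • EuclideanSpace.proj 0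
    have hφ : ∀ y, φ y = v 0 0 * y 1 - v 0 1 * y 0 := fun y => by simp [φ]
    have hφσ : ∀ s, φ (σ s) = φ (σ 0) := by
      intro s
      have h1 : ∀ s, HasDerivAt (fun s => φ (σ s)) 0 s := by
        intro s
        have := φ.hasFDerivAt.comp_hasDerivAt s (hσ s)
        rw [hdc s, map_smul, show φ (v 0) = 0 by rw [hφ]; ring, smul_zero] at this
        exact this
      exact is_const_of_deriv_eq_zero (fun s => (h1 s).differentiableAt) (fun s => (h1 s).deriv) s 0
    let ψ : (Plane × ℝ) →ₗ[ℝ] ℝ := (φ : Plane →ₗ[ℝ] ℝ).coprod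
      (LinearMap.toSpanSingleton ℝ ℝ (-φ (σ 0)))
    have hle : Submodule.span ℝ (hat '' (H '' Icc α β)) ≤ ψ.ker := by
      rw [Submodule.span_le]
      rintro _ ⟨_, ⟨t, ht, rfl⟩, rfl⟩
      obtain ⟨s, -, hs⟩ := hsub t ht
      rw [← hs]
      simp [ψ, hat, hφσ s]
    rw [hspan α β hα hαβ hβ] at hle
    have hφ0 : ∀ y, φ y = 0 := fun y => by
      have := hle (Submodule.mem_top (x := (y, (0 : ℝ))))
      simpa [ψ] using this
    apply hv0
    ext i
    fin_cases i
    · have := hφ0 (EuclideanSpace.single 1 1)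
      rw [hφ] at this
      simpa using this
    · have := hφ0 (EuclideanSpace.single 0 1)
      rw [hφ] at this
      simpa using this
  -- One application of `word S w` brings all of `γ` onto the orbit; in particular its fixed point
  -- `p` lies there.
  obtain ⟨w, hw, hwτ⟩ := hp.exists_small_copy hS hα hαβ hβ
  have hwσ : ∀ y ∈ γ, ∃ s ∈ Icc 0 s₁, word S w y = σ s := by
    intro y hy
    obtain ⟨s, hs, h⟩ := hsub _ (Ioo_subset_Icc_self (hwτ y hy))
    rw [hp.right_inv _ (hS.word_mem w hy)] at h
    exact ⟨s, hs, h.symm⟩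
  obtain ⟨p, hpγ, hfp, hfix, hlim⟩ := hS.exists_fixedPoint hp.isCompact hp.isConnected.nonempty hw
  obtain ⟨s₂, hs₂, hps₂⟩ := hwσ p hpγ
  rw [hfp] at hps₂
  have hnt : γ.Nontrivial := by
    refine ⟨H 0, hp.mem 0 (by simp), H 1, hp.mem 1 (by simp), fun h => ?_⟩
    exact zero_ne_one (hp.injOn (by simp) (by simp) h)
  have hit : ∀ y ∈ γ, ∀ k, (word S w)^[k] y ∈ γ := by
    intro y hy k
    induction k with
    | zero => exact hy
    | succ k ih =>
      rw [Function.iterate_succ_apply']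
      exact hS.word_mem w ih
  -- The injective map `E s₂` carries velocity and acceleration at time `0` to those at time `s₂`,
  -- so the orbit is curved at `p` too.
  have hli2 : LinearIndependent ℝ ![v s₂, a s₂] := by
    rw [LinearIndependent.pair_iff] at hli ⊢
    intro r t hrt
    apply hli
    have h1 : E s₂ (r • A (hat x) + t • A (A (hat x))) = E s₂ 0 := by
      rw [map_zero, map_add, map_smul, map_smul]
      exact Prod.ext hrt (by simp [hE2])
    have h2 := congrArg Prod.fst (hEinj s₂ h1)
    simpa [v, a, hE0] using h2
  obtain ⟨e₁, e₂, r, hli', hr, hcoord⟩ := exists_parabola_coords (hS.word_injective w) hfp hfix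
    (hnt.exists_ne p) hps₂.symm hσ (hv s₂) hli2 (fun y hy hyp => by
      choose s hs hσs using fun k => hwσ _ (hit y hy k)
      have hσs' : ∀ k, (word S w)^[k + 1] y = σ (s k) := fun k => by
        rw [Function.iterate_succ_apply', hσs]
      refine ⟨s, ?_, fun k hk => ?_, hσs'⟩
      · refine tendsto_of_tendsto_comp_of_injOn isCompact_Icc hσc.continuousOn hinj hs hs₂ ?_
        rw [← hps₂]
        exact ((hlim y).comp (tendsto_add_atTop_nat 1)).congr hσs'
      · have h1 : (word S w)^[k + 1] y = (word S w)^[k + 1] p := by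
          rw [hσs', hk, ← hps₂]
          exact (Function.IsFixedPt.iterate hfp (k + 1)).symm
        exact hyp ((hS.word_injective w).iterate (k + 1) h1))
  exact isParabolicSegment_of_coords hp.isCompact hp.isConnected hnt hli' hr hcoord

end

/-! ### Rigidity: finiteness of affine maps between subarcs -/

/-- `X` contains a basis, and the values on a basis bound the operator norm. -/
theorem isCompact_setOf_forall_mem {V : Type*} [NormedAddCommGroup V] [NormedSpace ℝ V]
    [FiniteDimensional ℝ V] {X K : Set V} (hX : Submodule.span ℝ X = ⊤) (hK : IsCompact K) :
    IsCompact {M : V →L[ℝ] V | ∀ x ∈ X, M x ∈ K} := by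
  obtain ⟨b, hbX, hbs, hbi⟩ := exists_linearIndependent ℝ X
  let B : Module.Basis b ℝ V := Module.Basis.mk hbi (by simp [hbs, hX])
  have : Fintype b := FiniteDimensional.fintypeBasisIndex B
  obtain ⟨C, hC0, hC⟩ := B.exists_opNorm_le (F := V)
  obtain ⟨R, hR⟩ := hK.isBounded.exists_norm_le
  have : ProperSpace (V →L[ℝ] V) := FiniteDimensional.proper_real _
  refine Metric.isCompact_of_isClosed_isBounded ?_ ?_
  · simp only [ofPred_forall]
    exact isClosed_biInter fun x _ =>
      hK.isClosed.preimage (ContinuousLinearMap.apply ℝ V x).continuous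
  · refine isBounded_iff_forall_norm_le.2 ⟨C * max R 0, fun M hM => ?_⟩
    refine hC (le_max_right _ _) fun i => ?_
    have : B i = i := by simp [B]
    rw [this]
    exact (hR _ (hM _ (hbX i.2))).trans (le_max_left _ _)

/-- The images are intervals spanned by the images of the ends, so convergence at four points
suffices. This makes the composite of `ψ (n + 1)` with the inverse of `ψ n` defined on the smaller
interval. -/
theorem eventually_image_subset {ψ : ℕ → ℝ → ℝ} {ψ₀ : ℝ → ℝ} {a a₁ b₁ b : ℝ} (ha : a < a₁)
    (hab : a₁ < b₁) (hb : b₁ < b) (hc : ∀ n, ContinuousOn (ψ n) (Icc a b))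
    (hi : ∀ n, InjOn (ψ n) (Icc a b)) (hc₀ : ContinuousOn ψ₀ (Icc a b))
    (hi₀ : InjOn ψ₀ (Icc a b)) (hlim : ∀ t ∈ Icc a b, Tendsto (fun n => ψ n t) atTop (𝓝 (ψ₀ t))) :
    ∀ᶠ n in atTop, ψ (n + 1) '' Icc a₁ b₁ ⊆ ψ n '' Icc a b := by
  have hle : a ≤ b := by linarith
  have hsub : Icc a₁ b₁ ⊆ Icc a b := Icc_subset_Icc ha.le hb.le
  have hma : a ∈ Icc a b := ⟨le_rfl, hle⟩
  have hma₁ : a₁ ∈ Icc a b := hsub ⟨le_rfl, hab.le⟩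
  have hmb₁ : b₁ ∈ Icc a b := hsub ⟨hab.le, le_rfl⟩
  have hmb : b ∈ Icc a b := ⟨hle, le_rfl⟩
  have hs := tendsto_add_atTop_nat 1
  have key : ∀ n, ψ n '' Icc a b = uIcc (ψ n a) (ψ n b) := fun n =>
    image_Icc_of_injOn hle (hc n) (hi n)
  have key' : ∀ n, ψ n '' Icc a₁ b₁ = uIcc (ψ n a₁) (ψ n b₁) := fun n =>
    image_Icc_of_injOn hab.le ((hc n).mono hsub) ((hi n).mono hsub)
  rcases hc₀.strictMonoOn_of_injOn_Icc' hle hi₀ with h | h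
  · obtain ⟨m₁, hm₁, hm₁'⟩ := exists_between (h hma hma₁ ha)
    obtain ⟨m₂, hm₂, hm₂'⟩ := exists_between (h hmb₁ hmb hb)
    have hm₁₂ := h hma₁ hmb₁ hab
    filter_upwards [(hlim a hma).eventually (gt_mem_nhds hm₁),
      (hlim b hmb).eventually (lt_mem_nhds hm₂'),
      hs.eventually ((hlim a₁ hma₁).eventually (Ioo_mem_nhds hm₁' (hm₁₂.trans hm₂))),
      hs.eventually ((hlim b₁ hmb₁).eventually (Ioo_mem_nhds (hm₁'.trans hm₁₂) hm₂))] with n h1 h2 h3 h4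
    rw [key, key']
    exact (uIcc_subset_Icc (Ioo_subset_Icc_self h3) (Ioo_subset_Icc_self h4)).trans
      ((Icc_subset_Icc h1.le h2.le).trans Icc_subset_uIcc)
  · obtain ⟨m₁, hm₁, hm₁'⟩ := exists_between (h hmb₁ hmb hb)
    obtain ⟨m₂, hm₂, hm₂'⟩ := exists_between (h hma hma₁ ha)
    have hm₁₂ := h hma₁ hmb₁ hab
    filter_upwards [(hlim b hmb).eventually (gt_mem_nhds hm₁),
      (hlim a hma).eventually (lt_mem_nhds hm₂'),
      hs.eventually ((hlim a₁ hma₁).eventually (Ioo_mem_nhds (hm₁'.trans hm₁₂) hm₂)),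
      hs.eventually ((hlim b₁ hmb₁).eventually (Ioo_mem_nhds hm₁' (hm₁₂.trans hm₂)))] with n h1 h2 h3 h4
    rw [key, key']
    exact (uIcc_subset_Icc (Ioo_subset_Icc_self h3) (Ioo_subset_Icc_self h4)).trans
      ((Icc_subset_Icc h1.le h2.le).trans Icc_subset_uIcc')

section
variable {m : ℕ} {S : Fin m → Plane →ᵃ[ℝ] Plane} {γ : Set Plane} {c : ℝ}
  {H : ℝ → Plane} {τ : Plane → ℝ}

/-- The linear map `M`, acting in homogeneous coordinates, takes the subarc `H '' [a, b]` into
the arc `γ`. -/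
def MapsSubarc (γ : Set Plane) (H : ℝ → Plane) (a b : ℝ) (M : (Plane × ℝ) →L[ℝ] (Plane × ℝ)) :
    Prop :=
  ∀ t ∈ Icc a b, M (hat (H t)) ∈ hat '' γ

theorem MapsSubarc.eq (hp : IsParam γ H τ) {a b : ℝ} {M : (Plane × ℝ) →L[ℝ] (Plane × ℝ)}
    (hM : MapsSubarc γ H a b M) {t : ℝ} (ht : t ∈ Icc a b) :
    (M (hat (H t))).1 ∈ γ ∧ M (hat (H t)) = hat (H (τ (M (hat (H t))).1)) := by
  obtain ⟨y, hy, h⟩ := hM t ht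
  rw [← h]
  exact ⟨hy, by rw [show (hat y).1 = y from rfl, hp.right_inv y hy]⟩

theorem MapsSubarc.continuousOn (hp : IsParam γ H τ) {a b : ℝ}
    {M : (Plane × ℝ) →L[ℝ] (Plane × ℝ)} (hM : MapsSubarc γ H a b M) :
    ContinuousOn (fun t => τ (M (hat (H t))).1) (Icc a b) :=
  hp.contOn.comp (continuous_fst.comp (M.continuous.comp
    (continuous_hat.comp hp.cont))).continuousOn fun _ ht => (hM.eq hp ht).1

theorem MapsSubarc.injOn (hp : IsParam γ H τ) {a b : ℝ} (ha : 0 ≤ a) (hb : b ≤ 1)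
    {M : (Plane × ℝ) →L[ℝ] (Plane × ℝ)} (hM : MapsSubarc γ H a b M) (hi : Function.Injective M) :
    InjOn (fun t => τ (M (hat (H t))).1) (Icc a b) := by
  intro s hs t ht hst
  have h1 := (hM.eq hp hs).2
  simp only at hst
  rw [hst, ← (hM.eq hp ht).2] at h1
  exact hp.injOn (Icc_subset_Icc ha hb hs) (Icc_subset_Icc ha hb ht) (hat_injective (hi h1))

/-- Only finitely many affine maps take a given subarc into the arc, while the inverse takes
another given subarc into the arc, unless the arc is a parabolic or a straight segment. -/
theorem finite_mapsSubarc (hp : IsParam γ H τ) (hS : IsSystem S γ c)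
    (hpar : ¬ IsParabolicSegment γ) (hseg : ¬ IsStraightSegment γ) {a b a' b' : ℝ} (ha : 0 ≤ a)
    (hab : a < b) (hb : b ≤ 1) (ha' : 0 ≤ a') (hab' : a' < b') (hb' : b' ≤ 1) :
    {M : (Plane × ℝ) →L[ℝ] (Plane × ℝ) | MapsSubarc γ H a b M ∧
      ∃ M', M * M' = 1 ∧ M' * M = 1 ∧ MapsSubarc γ H a' b' M'}.Finite := by
  by_contra hinf
  have hspan : ∀ a b, 0 ≤ a → a < b → b ≤ 1 → Submodule.span ℝ (hat '' (H '' Icc a b)) = ⊤ :=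
    fun a b => hp.span_subarc hS hseg
  have hcomp : ∀ a b, 0 ≤ a → a < b → b ≤ 1 →
      IsCompact {M : (Plane × ℝ) →L[ℝ] (Plane × ℝ) | MapsSubarc γ H a b M} := by
    intro a b ha hab hb
    have := isCompact_setOf_forall_mem (hspan a b ha hab hb) (hp.isCompact.image continuous_hat)
    simpa only [forall_mem_image, MapsSubarc] using this
  let f := Set.Infinite.natEmbedding _ hinf
  choose hf1 M' hMM' hM'M hM' using fun n => (f n).2
  obtain ⟨⟨F, F'⟩, ⟨hF, hF'⟩, φ, hφ, hlim⟩ :=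
    ((hcomp a b ha hab hb).prod (hcomp a' b' ha' hab' hb')).tendsto_subseq
      (x := fun n => ((f n : (Plane × ℝ) →L[ℝ] (Plane × ℝ)), M' n)) (fun n => ⟨hf1 n, hM' n⟩)
  have hlim1 : Tendsto (fun n => (f (φ n) : (Plane × ℝ) →L[ℝ] (Plane × ℝ))) atTop (𝓝 F) :=
    (continuous_fst.tendsto _).comp hlim
  have hlim2 : Tendsto (fun n => M' (φ n)) atTop (𝓝 F') := (continuous_snd.tendsto _).comp hlim
  have hFF : F' * F = 1 := tendsto_nhds_unique (hlim2.mul hlim1)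
    (tendsto_const_nhds.congr fun n => (hM'M (φ n)).symm)
  have hinj : ∀ M M' : (Plane × ℝ) →L[ℝ] (Plane × ℝ), M' * M = 1 → Function.Injective M := by
    intro M M' h u v huv
    have h1 : ∀ u, M' (M u) = u := fun u => by rw [← mul_apply_eq_comp, h]; rfl
    rw [← h1 u, huv, h1]
  -- The quotient of two successive terms tends to `1`, but never equals it since the maps `f n` are
  -- pairwise distinct.
  have hg1 : Tendsto (fun n => M' (φ n) * (f (φ (n + 1)) : (Plane × ℝ) →L[ℝ] (Plane × ℝ))) atTop
      (𝓝 1) := by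
    have h := hlim2.mul (hlim1.comp (tendsto_add_atTop_nat 1))
    rwa [hFF] at h
  have hne : ∀ n, M' (φ n) * (f (φ (n + 1)) : (Plane × ℝ) →L[ℝ] (Plane × ℝ)) ≠ 1 := by
    intro n h
    have h1 := congrArg (fun M => (f (φ n) : (Plane × ℝ) →L[ℝ] (Plane × ℝ)) * M) h
    simp only [← mul_assoc, hMM', one_mul, mul_one] at h1
    have := hφ.injective (f.injective (Subtype.ext h1))
    omega
  obtain ⟨a₁, haa₁, ha₁b⟩ := exists_between hab
  obtain ⟨b₁, ha₁b₁, hb₁b⟩ := exists_between ha₁b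
  have hev := eventually_image_subset haa₁ ha₁b₁ hb₁b
    (fun n => (hf1 (φ n)).continuousOn hp)
    (fun n => (hf1 (φ n)).injOn hp ha hb (hinj _ _ (hM'M _)))
    (MapsSubarc.continuousOn hp hF) (MapsSubarc.injOn hp ha hb hF (hinj _ _ hFF)) (by
      intro t ht
      have h1 : Tendsto (fun n => ((f (φ n) : (Plane × ℝ) →L[ℝ] (Plane × ℝ)) (hat (H t))).1) atTop
          (𝓝 (F (hat (H t))).1) :=
        (continuous_fst.tendsto _).comp
          (((ContinuousLinearMap.apply ℝ (Plane × ℝ) (hat (H t))).continuous.tendsto F).comp hlim1)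
      have h2 := hp.contOn _ (MapsSubarc.eq hp hF ht).1
      exact h2.tendsto.comp (tendsto_nhdsWithin_iff.2
        ⟨h1, Eventually.of_forall fun n => ((hf1 (φ n)).eq hp ht).1⟩))
  obtain ⟨N, hN⟩ := eventually_atTop.1 hev
  obtain ⟨A, hA, x, -, hAx, s₀, hs₀, horb⟩ := exists_orbit_of_tendsto_one hp hspan
    (hg1.comp (tendsto_add_atTop_nat N)) (fun n => hne (n + N)) (ha.trans haa₁.le) ha₁b₁
    (hb₁b.le.trans hb) (by
      intro n t ht
      have htab : t ∈ Icc a b := ⟨haa₁.le.trans ht.1, ht.2.trans hb₁b.le⟩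
      obtain ⟨t', ht', h⟩ := hN (n + N) (by omega) (mem_image_of_mem _ ht)
      simp only at h
      refine ⟨H t', hp.mem _ ⟨ha.trans ht'.1, ht'.2.trans hb⟩, ?_⟩
      simp only [Function.comp, mul_apply_eq_comp]
      rw [((hf1 _).eq hp htab).2, ← h, ← ((hf1 _).eq hp ht').2, ← mul_apply_eq_comp, hM'M]
      rfl)
  exact hpar (isParabolicSegment_of_orbit hp hS hspan hA hAx hs₀ horb)

end

/-! ### Preimages of cut points -/

section
variable {m : ℕ} {S : Fin m → Plane →ᵃ[ℝ] Plane} {γ : Set Plane} {c : ℝ}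
  {H : ℝ → Plane} {τ : Plane → ℝ}

/-- The parameters of the endpoints of the arcs `S j '' γ`. -/
def cutPoints (S : Fin m → Plane →ᵃ[ℝ] Plane) (H : ℝ → Plane) : Set ℝ :=
  {x | x ∈ Icc (0 : ℝ) 1 ∧ ∃ j, ∃ e ∈ ({0, 1} : Set ℝ), S j (H e) = H x}

theorem mem_Icc_of_mem_pair {e : ℝ} (he : e ∈ ({0, 1} : Set ℝ)) : e ∈ Icc (0 : ℝ) 1 := by
  rcases he with rfl | rfl <;> simp

theorem finite_cutPoints (hp : IsParam γ H τ) : (cutPoints S H).Finite := by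
  have hfin : (⋃ j, (fun e => τ (S j (H e))) '' ({0, 1} : Set ℝ)).Finite :=
    finite_iUnion fun j => (Set.toFinite _).image _
  refine hfin.subset ?_
  rintro x ⟨hx, j, e, he, h⟩
  exact mem_iUnion.2 ⟨j, e, he, by simp only [h, hp.left_inv x hx]⟩

theorem continuous_affine (f : Plane →ᵃ[ℝ] Plane) : Continuous f :=
  f.continuous_of_finiteDimensional

theorem IsParam.image_word (hp : IsParam γ H τ) (hS : IsSystem S γ c) (w : List (Fin m)) {a b : ℝ}
    (ha : a ∈ Icc (0 : ℝ) 1) (hb : b ∈ Icc (0 : ℝ) 1) :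
    word S w '' (H '' uIcc a b) = H '' uIcc (τ (word S w (H a))) (τ (word S w (H b))) :=
  hp.image_uIcc (continuous_affine _) (hS.word_injective w) ha hb fun _ ht =>
    hS.word_mem w (hp.mem _ (uIcc_subset_Icc ha hb ht))

theorem IsParam.image_word_arc (hp : IsParam γ H τ) (hS : IsSystem S γ c) (w : List (Fin m)) :
    word S w '' γ = H '' uIcc (τ (word S w (H 0))) (τ (word S w (H 1))) := by
  rw [← hp.image_word hS w (by simp) (by simp), uIcc_of_le zero_le_one, hp.image_eq]

/-- In the parameter, the maps of the system are strictly monotone. -/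
theorem IsParam.between_word (hp : IsParam γ H τ) (hS : IsSystem S γ c) (w : List (Fin m)) {z : ℝ}
    (hz : z ∈ Ioo (0 : ℝ) 1) :
    (τ (word S w (H 0)) < τ (word S w (H z)) ∧ τ (word S w (H z)) < τ (word S w (H 1))) ∨
    (τ (word S w (H 1)) < τ (word S w (H z)) ∧ τ (word S w (H z)) < τ (word S w (H 0))) := by
  have hc : ContinuousOn (fun t => τ (word S w (H t))) (Icc 0 1) :=
    hp.contOn.comp ((continuous_affine _).comp hp.cont).continuousOn
      fun t ht => hS.word_mem w (hp.mem t ht)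
  have hi : InjOn (fun t => τ (word S w (H t))) (Icc 0 1) := by
    intro s hs t ht hst
    have := congrArg H hst
    simp only [hp.right_inv _ (hS.word_mem w (hp.mem s hs)),
      hp.right_inv _ (hS.word_mem w (hp.mem t ht))] at this
    exact hp.injOn hs ht (hS.word_injective w this)
  have h0 : (0 : ℝ) ∈ Icc (0 : ℝ) 1 := by simp
  have h1 : (1 : ℝ) ∈ Icc (0 : ℝ) 1 := by simp
  have hz' := Ioo_subset_Icc_self hz
  rcases hc.strictMonoOn_of_injOn_Icc' zero_le_one hi with h | h
  · exact Or.inl ⟨h h0 hz' hz.1, h hz' h1 hz.2⟩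
  · exact Or.inr ⟨h hz' h1 hz.2, h h0 hz' hz.1⟩

theorem IsParam.mem_pair_of_word_eq (hp : IsParam γ H τ) (hS : IsSystem S γ c) {w : List (Fin m)}
    {z e : ℝ} (hz : z ∈ Icc (0 : ℝ) 1) (he : e ∈ ({0, 1} : Set ℝ)) (h : word S w (H z) = H e) :
    z ∈ ({0, 1} : Set ℝ) := by
  by_contra hne
  have hz' : z ∈ Ioo (0 : ℝ) 1 := by
    simp only [mem_insert_iff, mem_singleton_iff, not_or] at hne
    exact ⟨lt_of_le_of_ne hz.1 (Ne.symm hne.1), lt_of_le_of_ne hz.2 hne.2⟩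
  have h1 := hp.between_word hS w hz'
  rw [h, hp.left_inv e (mem_Icc_of_mem_pair he)] at h1
  have i0 := hp.inv_mem _ (hS.word_mem w (hp.mem 0 (by simp)))
  have i1 := hp.inv_mem _ (hS.word_mem w (hp.mem 1 (by simp)))
  rcases he with rfl | rfl
  · rcases h1 with h1 | h1 <;> linarith [i0.1, i1.1]
  · rcases h1 with h1 | h1 <;> linarith [i0.2, i1.2]

theorem mem_cutPoints_of_mem_pair (hp : IsParam γ H τ) (hS : IsSystem S γ c) {e : ℝ}
    (he : e ∈ ({0, 1} : Set ℝ)) : e ∈ cutPoints S H := by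
  have he' := mem_Icc_of_mem_pair he
  obtain ⟨j, y, hy, h⟩ := hS.exists_map_eq (hp.mem e he')
  refine ⟨he', j, τ y, ?_, by rw [hp.right_inv y hy, h]⟩
  exact hp.mem_pair_of_word_eq hS (w := [j]) (hp.inv_mem y hy) he (by simp [hp.right_inv y hy, h])

/-- An interval that starts at `q` and leaves the interval around it swallows the side through which
it leaves. -/
theorem uIcc_subset_of_between {q b s t : ℝ} (h : (s < q ∧ q < t) ∨ (t < q ∧ q < s))
    (hb : b ∉ uIcc s t) : uIcc s q ⊆ uIcc q b ∨ uIcc q t ⊆ uIcc q b := by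
  have key : ∀ s t : ℝ, s < q → q < t → b ∉ Icc s t →
      uIcc s q ⊆ uIcc q b ∨ uIcc q t ⊆ uIcc q b := by
    intro s t hs ht hb
    rcases lt_or_ge b s with h | h
    · left
      rw [uIcc_comm q b]
      rw [uIcc_of_le hs.le, uIcc_of_le (by linarith)]
      exact Icc_subset_Icc h.le le_rfl
    · right
      have : t < b := by
        by_contra hle
        exact hb ⟨h, not_lt.1 hle⟩
      rw [uIcc_of_le ht.le, uIcc_of_le (by linarith)]
      exact Icc_subset_Icc le_rfl this.le
  rcases h with h | h
  · exact key s t h.1 h.2 fun h' => hb (Icc_subset_uIcc h')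
  · rcases key t s h.1 h.2 fun h' => hb (Icc_subset_uIcc' h') with h' | h'
    · exact Or.inr (by rwa [uIcc_comm])
    · exact Or.inl (by rwa [uIcc_comm])

/-- If a cut point `q` lies inside the copy `word S w '' γ`, then some copy with an endpoint at `q`,
or `γ` itself, contains the part of `word S w '' γ` on one side of `q`, while a copy of the next
level is contained in `word S w '' γ`. -/
theorem exists_comparable_word (hp : IsParam γ H τ) (hS : IsSystem S γ c) {w : List (Fin m)}
    {z q : ℝ} (hz : z ∈ Ioo (0 : ℝ) 1) (hq : q ∈ cutPoints S H) (h : word S w (H z) = H q) :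
    ∃ (u : List (Fin m)) (j : Fin m), ∃ x ∈ cutPoints S H, word S u (H x) = H q ∧
      (∀ y ∈ γ, word S u (S j y) ∈ word S w '' γ) ∧
      ((∀ t ∈ Icc 0 z, word S w (H t) ∈ word S u '' γ) ∨
        (∀ t ∈ Icc z 1, word S w (H t) ∈ word S u '' γ)) := by
  by_contra hcon
  have hz' := Ioo_subset_Icc_self hz
  have hbet := hp.between_word hS w hz
  rw [h, hp.left_inv q hq.1] at hbet
  -- Descend through nested copies with an endpoint at `q`, starting from `γ`. The first one
  -- contained in `word S w '' γ` would give, with its predecessor as `u`, the wanted pair; so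
  -- without such a pair the descent never enters `word S w '' γ`.
  have claim : ∀ k : ℕ, ∃ u : List (Fin m), u.length = k ∧ ∃ x ∈ cutPoints S H,
      (x ∈ ({0, 1} : Set ℝ) ∨ u = []) ∧ word S u (H x) = H q ∧
      ¬ word S u '' γ ⊆ word S w '' γ := by
    intro k
    induction k with
    | zero =>
      refine ⟨[], rfl, q, hq, Or.inr rfl, rfl, fun hsub => hcon ?_⟩
      obtain ⟨j, -⟩ := hq.2
      refine ⟨[], j, q, hq, rfl, fun y hy => hsub ⟨S j y, hS.map_mem j hy, rfl⟩,
        Or.inl fun t ht => ⟨_, hS.word_mem w (hp.mem t ⟨ht.1, ht.2.trans hz.2.le⟩), rfl⟩⟩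
    | succ k ih =>
      obtain ⟨u, hu, x, hx, hxu, hux, hsub⟩ := ih
      obtain ⟨j, e, he, hje⟩ := hx.2
      refine ⟨u ++ [j], by simp [hu], e, mem_cutPoints_of_mem_pair hp hS he, Or.inl he, ?_,
        fun hsub' => hcon ⟨u, j, x, hx, hux, fun y hy => ?_, ?_⟩⟩
      · rw [word_append]
        simp [hje, hux]
      · exact hsub' ⟨y, hy, by rw [word_append]; rfl⟩
      · rcases hxu with hx01 | rfl
        · -- the other endpoint
          obtain ⟨b, hb⟩ : ∃ b, word S u '' γ = H '' uIcc q b := by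
            rcases hx01 with rfl | rfl
            · exact ⟨τ (word S u (H 1)), by
                rw [hp.image_word_arc hS, hux, hp.left_inv q hq.1]⟩
            · exact ⟨τ (word S u (H 0)), by
                rw [hp.image_word_arc hS, hux, hp.left_inv q hq.1, uIcc_comm]⟩
          rw [hb, hp.image_word_arc hS w] at hsub
          have hbw : b ∉ uIcc (τ (word S w (H 0))) (τ (word S w (H 1))) := by
            intro hbw
            refine hsub (image_mono (uIcc_subset_uIcc ?_ hbw))
            rcases hbet with h' | h'
            · exact Icc_subset_uIcc ⟨h'.1.le, h'.2.le⟩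
            · exact Icc_subset_uIcc' ⟨h'.1.le, h'.2.le⟩
          rw [hb]
          rcases uIcc_subset_of_between hbet hbw with h' | h'
          · left
            intro t ht
            refine image_mono h' ?_
            have := hp.image_word hS w (a := 0) (b := z) (by simp) hz'
            rw [h, hp.left_inv q hq.1] at this
            rw [← this, uIcc_of_le hz.1.le]
            exact mem_image_of_mem _ (mem_image_of_mem _ ht)
          · right
            intro t ht
            refine image_mono h' ?_
            have := hp.image_word hS w (a := z) (b := 1) hz' (by simp)
            rw [h, hp.left_inv q hq.1] at this
            rw [← this, uIcc_of_le hz.2.le]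
            exact mem_image_of_mem _ (mem_image_of_mem _ ht)
        · exact Or.inl fun t ht =>
            ⟨_, hS.word_mem w (hp.mem t ⟨ht.1, ht.2.trans hz.2.le⟩), rfl⟩
  have hm : min (τ (word S w (H 0))) (τ (word S w (H 1))) < q ∧
      q < max (τ (word S w (H 0))) (τ (word S w (H 1))) := by
    rcases hbet with h' | h'
    · exact ⟨(min_le_left _ _).trans_lt h'.1, h'.2.trans_le (le_max_right _ _)⟩
    · exact ⟨(min_le_right _ _).trans_lt h'.1, h'.2.trans_le (le_max_left _ _)⟩
  -- But `q` is interior to the parameter interval of `word S w '' γ`, so every sufficiently small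
  -- copy through it lies inside.
  obtain ⟨r, hr, hball⟩ := hp.exists_ball hq.1 hm.1 hm.2
  obtain ⟨D, -, hD⟩ := hp.exists_dist_le
  obtain ⟨k, -, hk⟩ := hS.exists_pow_mul_lt D hr
  obtain ⟨u, rfl, x, hx, -, hux, hsub⟩ := claim k
  apply hsub
  rintro _ ⟨y, hy, rfl⟩
  rw [hp.image_word_arc hS w]
  refine ⟨_, Ioo_subset_Icc_self (hball _ (hS.word_mem u hy) ?_), hp.right_inv _ (hS.word_mem u hy)⟩
  rw [← hux]
  refine lt_of_le_of_lt ((hS.dist_word_le u _ _).trans ?_) hk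
  exact mul_le_mul_of_nonneg_left (hD y hy _ (hp.mem x hx.1)) (pow_nonneg hS.nonneg _)

/-- Away from the endpoints of the arc there are only finitely many preimages of cut points. -/
theorem finite_preimages_cutPoints (hp : IsParam γ H τ) (hS : IsSystem S γ c)
    (hpar : ¬ IsParabolicSegment γ) (hseg : ¬ IsStraightSegment γ) {ε : ℝ} (hε : 0 < ε) :
    {z | z ∈ Icc ε (1 - ε) ∧ ∃ w, ∃ q ∈ cutPoints S H, word S w (H z) = H q}.Finite := by
  rcases le_or_gt 1 ε with hε1 | hε1
  · refine Set.finite_empty.subset ?_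
    rintro z ⟨hz, -⟩
    linarith [hz.1, hz.2]
  let α : Fin m → ℝ := fun j => min (τ (S j (H 0))) (τ (S j (H 1)))
  let β : Fin m → ℝ := fun j => max (τ (S j (H 0))) (τ (S j (H 1)))
  have h0 : ∀ j, τ (S j (H 0)) ∈ Icc (0 : ℝ) 1 := fun j =>
    hp.inv_mem _ (hS.map_mem j (hp.mem 0 (by simp)))
  have h1 : ∀ j, τ (S j (H 1)) ∈ Icc (0 : ℝ) 1 := fun j =>
    hp.inv_mem _ (hS.map_mem j (hp.mem 1 (by simp)))
  have hα : ∀ j, 0 ≤ α j := fun j => le_min (h0 j).1 (h1 j).1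
  have hβ : ∀ j, β j ≤ 1 := fun j => max_le (h0 j).2 (h1 j).2
  have hαβ : ∀ j, α j < β j := by
    intro j
    refine min_lt_max.2 fun h => ?_
    have := congrArg H h
    rw [hp.right_inv _ (hS.map_mem j (hp.mem 0 (by simp))),
      hp.right_inv _ (hS.map_mem j (hp.mem 1 (by simp)))] at this
    exact zero_ne_one (hp.injOn (by simp) (by simp) (hS.inj j this))
  have harc : ∀ j, S j '' γ = H '' Icc (α j) (β j) := fun j => hp.image_word_arc hS [j]
  -- The quotient `M` of `word S u` by `word S w` belongs to such a finite set, and `z` is recovered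
  -- as the parameter of `M` applied to a cut point.
  let F : Fin m → ℝ → ℝ → Set ((Plane × ℝ) →L[ℝ] (Plane × ℝ)) := fun j a' b' =>
    {M | MapsSubarc γ H (α j) (β j) M ∧ ∃ M', M * M' = 1 ∧ M' * M = 1 ∧ MapsSubarc γ H a' b' M'}
  have hF : ∀ j a' b', 0 ≤ a' → a' < b' → b' ≤ 1 → (F j a' b').Finite := fun j a' b' =>
    finite_mapsSubarc hp hS hpar hseg (hα j) (hαβ j) (hβ j)
  have hfin : (⋃ j, image2 (fun M x => τ (M (hat (H x))).1) (F j 0 ε ∪ F j (1 - ε) 1)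
      (cutPoints S H)).Finite :=
    finite_iUnion fun j => ((hF j 0 ε le_rfl hε hε1.le).union
      (hF j (1 - ε) 1 (by linarith) (by linarith) le_rfl)).image2 _ (finite_cutPoints hp)
  refine hfin.subset ?_
  rintro z ⟨hz, w, q, hq, h⟩
  have hz01 : z ∈ Ioo (0 : ℝ) 1 := ⟨by linarith [hz.1], by linarith [hz.2]⟩
  obtain ⟨u, j, x, hx, hux, hj, hside⟩ := exists_comparable_word hp hS hz01 hq h
  obtain ⟨Wi, hWi, hWi'⟩ := exists_inverse_lift (hS.word_injective w)
  obtain ⟨Ui, hUi, hUi'⟩ := exists_inverse_lift (hS.word_injective u)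
  have hWi1 : ∀ v, Wi (lift (word S w) v) = v := fun v => by
    rw [← mul_apply_eq_comp, hWi]; rfl
  have hUi1 : ∀ v, Ui (lift (word S u) v) = v := fun v => by
    rw [← mul_apply_eq_comp, hUi]; rfl
  have hM : MapsSubarc γ H (α j) (β j) (Wi * lift (word S u)) := by
    intro t ht
    obtain ⟨y, hy, hyt⟩ : H t ∈ S j '' γ := harc j ▸ mem_image_of_mem H ht
    obtain ⟨y', hy', hyy⟩ := hj y hy
    refine ⟨y', hy', ?_⟩
    rw [mul_apply_eq_comp, lift_hat, ← hyt, ← hyy, ← lift_hat, hWi1]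
  have hM' : ∀ t, word S w (H t) ∈ word S u '' γ →
      (Ui * lift (word S w)) (hat (H t)) ∈ hat '' γ := by
    rintro t ⟨y, hy, hyt⟩
    refine ⟨y, hy, ?_⟩
    rw [mul_apply_eq_comp, lift_hat, ← hyt, ← lift_hat, hUi1]
  have hinv1 : Wi * lift (word S u) * (Ui * lift (word S w)) = 1 := by
    rw [mul_assoc, ← mul_assoc _ Ui, hUi', one_mul, hWi]
  have hinv2 : Ui * lift (word S w) * (Wi * lift (word S u)) = 1 := by
    rw [mul_assoc, ← mul_assoc _ Wi, hWi', one_mul, hUi]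
  refine mem_iUnion.2 ⟨j, Wi * lift (word S u), ?_, x, hx, ?_⟩
  -- The inverse quotient is controlled on one side of `z`, hence, as `ε ≤ z ≤ 1 - ε`, on an end
  -- interval that does not depend on `z`.
  · rcases hside with hs | hs
    · exact Or.inl ⟨hM, _, hinv1, hinv2, fun t ht => hM' t (hs t ⟨ht.1, ht.2.trans hz.1⟩)⟩
    · exact Or.inr ⟨hM, _, hinv1, hinv2, fun t ht => hM' t (hs t ⟨hz.2.trans ht.1, ht.2⟩)⟩
  · simp only
    rw [mul_apply_eq_comp, lift_hat, hux, ← h, ← lift_hat, hWi1]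
    exact hp.left_inv z (Ioo_subset_Icc_self hz01)

end

/-! ### Finite backward orbits and the Markov partition -/

theorem exists_pos_le_of_finite {s : Set ℝ} (hs : s.Finite) (hpos : ∀ x ∈ s, 0 < x) :
    ∃ δ > 0, ∀ x ∈ s, δ ≤ x := by
  rcases s.eq_empty_or_nonempty with rfl | hne
  · exact ⟨1, one_pos, by simp⟩
  · obtain ⟨δ, hδ, hmin⟩ := hs.exists_minimalFor id s hne
    exact ⟨δ, hpos δ hδ, fun x hx => le_of_not_gt fun h => (hmin hx h.le).not_gt h⟩

theorem finite_range_iterate_of_eq {X : Type*} {T : X → X} {x : X} {k l : ℕ} (hkl : k < l)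
    (h : T^[k] x = T^[l] x) : (range fun n => T^[n] x).Finite := by
  refine ((Set.finite_Iio l).image fun n => T^[n] x).subset ?_
  rintro _ ⟨n, rfl⟩
  induction n using Nat.strong_induction_on with
  | _ n ih =>
    rcases lt_or_ge n l with hn | hn
    · exact ⟨n, hn, rfl⟩
    · have h1 : T^[n] x = T^[n - l + k] x := by
        conv_lhs => rw [← Nat.sub_add_cancel hn]
        rw [Function.iterate_add_apply, ← h, ← Function.iterate_add_apply]
      simp only [h1]
      exact ih _ (by omega)

section
variable {m : ℕ} {S : Fin m → Plane →ᵃ[ℝ] Plane} {γ : Set Plane} {c : ℝ}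
  {H : ℝ → Plane} {τ : Plane → ℝ}

theorem exists_separation (hp : IsParam γ H τ) :
    ∃ ρ > 0, ∀ q ∈ cutPoints S H, ∀ q' ∈ cutPoints S H,
      dist (H q) (H q') < 2 * ρ → q = q' := by
  have hfin := finite_cutPoints (S := S) hp
  obtain ⟨δ, hδ, h⟩ := exists_pos_le_of_finite
    ((hfin.offDiag).image fun q => dist (H q.1) (H q.2)) (by
      rintro _ ⟨⟨q, q'⟩, ⟨hq, hq', hne⟩, rfl⟩
      exact dist_pos.2 fun h => hne (hp.injOn hq.1 hq'.1 h))
  refine ⟨δ / 2, by positivity, fun q hq q' hq' hd => ?_⟩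
  by_contra hne
  have := h _ ⟨⟨q, q'⟩, ⟨hq, hq', hne⟩, rfl⟩
  simp only at this
  linarith

/-- Backward orbits of preimages of cut points, with an arbitrary choice of the inverse branch at
each point, are finite. -/
theorem finite_backward_orbit (hp : IsParam γ H τ) (hS : IsSystem S γ c)
    (hpar : ¬ IsParabolicSegment γ) (hseg : ¬ IsStraightSegment γ) {T : ℝ → ℝ}
    (hT : ∀ x ∈ Icc (0 : ℝ) 1, T x ∈ Icc (0 : ℝ) 1 ∧ ∃ i, S i (H (T x)) = H x) {x₀ : ℝ}
    (hx₀ : x₀ ∈ Icc (0 : ℝ) 1) (hcut : ∃ w, ∃ q ∈ cutPoints S H, word S w (H x₀) = H q) :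
    (range fun k => T^[k] x₀).Finite := by
  have hY : ∀ k, T^[k] x₀ ∈ Icc (0 : ℝ) 1 ∧
      ∃ w, ∃ q ∈ cutPoints S H, word S w (H (T^[k] x₀)) = H q := by
    intro k
    induction k with
    | zero => exact ⟨hx₀, hcut⟩
    | succ k ih =>
      obtain ⟨h1, w, q, hq, hw⟩ := ih
      obtain ⟨h2, i, hi⟩ := hT _ h1
      rw [Function.iterate_succ_apply']
      exact ⟨h2, w ++ [i], q, hq, by rw [word_append, word_cons, word_nil, hi, hw]⟩
  obtain ⟨ρ, hρ, hsep⟩ := exists_separation (S := S) hp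
  obtain ⟨ε, hε, hnear⟩ : ∃ ε > 0, ∀ e ∈ ({0, 1} : Set ℝ), ∀ t, dist t e < ε →
      dist (H t) (H e) < ρ := by
    obtain ⟨ε₀, hε₀, h₀⟩ := Metric.continuous_iff.1 hp.cont 0 ρ hρ
    obtain ⟨ε₁, hε₁, h₁⟩ := Metric.continuous_iff.1 hp.cont 1 ρ hρ
    refine ⟨min ε₀ ε₁, lt_min hε₀ hε₁, ?_⟩
    rintro e (rfl | rfl) t ht
    · exact h₀ t (ht.trans_le (min_le_left _ _))
    · exact h₁ t (ht.trans_le (min_le_right _ _))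
  -- Infinitely many visits to the middle, where only finitely many values are possible, force a
  -- repetition. Otherwise the orbit eventually stays near the ends.
  by_cases hinf : {k | T^[k] x₀ ∈ Icc ε (1 - ε)}.Infinite
  · obtain ⟨k, -, l, -, hkl, h⟩ := hinf.exists_lt_map_eq_of_mapsTo (f := fun k => T^[k] x₀)
      (t := {z | z ∈ Icc ε (1 - ε) ∧ ∃ w, ∃ q ∈ cutPoints S H, word S w (H z) = H q})
      (fun k hk => ⟨hk, (hY k).2⟩) (finite_preimages_cutPoints hp hS hpar hseg hε)
    exact finite_range_iterate_of_eq hkl h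
  · obtain ⟨N, hN⟩ := (not_infinite.1 hinf).bddAbove
    have hend : ∀ k, N < k → ∃ e ∈ ({0, 1} : Set ℝ), dist (H (T^[k] x₀)) (H e) < ρ := by
      intro k hk
      have h1 : T^[k] x₀ ∉ Icc ε (1 - ε) := fun h => (hN h).not_gt hk
      have h2 := (hY k).1
      rcases lt_or_ge (T^[k] x₀) ε with h | h
      · refine ⟨0, by simp, hnear 0 (by simp) _ ?_⟩
        rwa [Real.dist_eq, sub_zero, abs_of_nonneg h2.1]
      · have h3 : 1 - ε < T^[k] x₀ := lt_of_not_ge fun h' => h1 ⟨h, h'⟩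
        refine ⟨1, by simp, hnear 1 (by simp) _ ?_⟩
        rw [Real.dist_eq, abs_sub_comm, abs_of_nonneg (by linarith [h2.2])]
        linarith
    obtain ⟨D, -, hD⟩ := hp.exists_dist_le
    -- The branch taking step `k + 1` back to step `k` sends the nearby end `e'` to a cut point
    -- within `2 * ρ` of `H e`, hence to `H e`. So the distance at step `k` is at most `c` times the
    -- one at step `k + 1`; iterating `j` times leaves the factor `c ^ j`.
    have claim : ∀ j k, N < k → ∀ e ∈ ({0, 1} : Set ℝ), dist (H (T^[k] x₀)) (H e) < ρ →
        dist (H (T^[k] x₀)) (H e) ≤ c ^ j * D := by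
      intro j
      induction j with
      | zero =>
        intro k _ e he _
        rw [pow_zero, one_mul]
        exact hD _ (hp.mem _ (hY k).1) _ (hp.mem _ (mem_Icc_of_mem_pair he))
      | succ j ih =>
        intro k hk e he hd
        obtain ⟨e', he', hd'⟩ := hend (k + 1) (by omega)
        obtain ⟨-, i, hi⟩ := hT _ (hY k).1
        rw [← Function.iterate_succ_apply' T] at hi
        have hle := hS.dist_le i (H (T^[k + 1] x₀)) (H e')
        rw [hi] at hle
        have hee : S i (H e') = H e := by
          have hmem := hS.map_mem i (hp.mem _ (mem_Icc_of_mem_pair he'))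
          have hr := hp.right_inv _ hmem
          have h1 : τ (S i (H e')) = e := by
            refine hsep _ ⟨hp.inv_mem _ hmem, i, e', he', hr.symm⟩ _
              (mem_cutPoints_of_mem_pair hp hS he) ?_
            rw [hr]
            have h2 := dist_triangle_left (S i (H e')) (H e) (H (T^[k] x₀))
            have h3 : c * dist (H (T^[k + 1] x₀)) (H e') ≤ dist (H (T^[k + 1] x₀)) (H e') :=
              mul_le_of_le_one_left dist_nonneg hS.lt_one.le
            linarith
          rw [← hr, h1]
        rw [hee] at hle
        calc _ ≤ c * dist (H (T^[k + 1] x₀)) (H e') := hle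
          _ ≤ c * (c ^ j * D) :=
            mul_le_mul_of_nonneg_left (ih (k + 1) (by omega) e' he' hd') hS.nonneg
          _ = c ^ (j + 1) * D := by ring
    refine (((Set.finite_Iic N).image fun k => T^[k] x₀).union
      (Set.toFinite ({0, 1} : Set ℝ))).subset ?_
    rintro _ ⟨k, rfl⟩
    rcases le_or_gt k N with hk | hk
    · exact Or.inl ⟨k, hk, rfl⟩
    · right
      obtain ⟨e, he, hd⟩ := hend k hk
      have h0 : dist (H (T^[k] x₀)) (H e) = 0 := by
        by_contra hne
        obtain ⟨j, -, hj⟩ := hS.exists_pow_mul_lt D (lt_of_le_of_ne dist_nonneg (Ne.symm hne))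
        exact (claim j k hk e he hd).not_gt hj
      simp only
      rwa [hp.injOn (hY k).1 (mem_Icc_of_mem_pair he) (dist_eq_zero.1 h0)]

theorem IsParam.exists_arc_eq (hp : IsParam γ H τ) (hS : IsSystem S γ c) (i : Fin m) :
    ∃ s ∈ cutPoints S H, ∃ t ∈ cutPoints S H, s ≤ t ∧ S i '' γ = H '' Icc s t := by
  have hmem : ∀ e ∈ ({0, 1} : Set ℝ), τ (S i (H e)) ∈ cutPoints S H := fun e he => by
    have h := hS.map_mem i (hp.mem _ (mem_Icc_of_mem_pair he))
    exact ⟨hp.inv_mem _ h, i, e, he, (hp.right_inv _ h).symm⟩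
  have h : S i '' γ = H '' uIcc (τ (S i (H 0))) (τ (S i (H 1))) := hp.image_word_arc hS [i]
  refine ⟨min (τ (S i (H 0))) (τ (S i (H 1))), ?_, max (τ (S i (H 0))) (τ (S i (H 1))), ?_,
    min_le_max, h⟩
  · rcases min_choice (τ (S i (H 0))) (τ (S i (H 1))) with h | h <;> rw [h]
    exacts [hmem 0 (by simp), hmem 1 (by simp)]
  · rcases max_choice (τ (S i (H 0))) (τ (S i (H 1))) with h | h <;> rw [h]
    exacts [hmem 0 (by simp), hmem 1 (by simp)]

/-- A self-affine arc that is not a parabolic or straight segment has a finite Markov partition. -/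
theorem exists_markov_partition (hp : IsParam γ H τ) (hS : IsSystem S γ c)
    (hpar : ¬ IsParabolicSegment γ) (hseg : ¬ IsStraightSegment γ) :
    ∃ P : Finset ℝ, 0 ∈ P ∧ 1 ∈ P ∧ (∀ x ∈ P, x ∈ Icc (0 : ℝ) 1) ∧
      ∀ p ∈ P, ∀ p' ∈ P, p < p' → (∀ x ∈ P, ¬ (p < x ∧ x < p')) →
        ∃ i, ∃ a ∈ P, ∃ b ∈ P, S i (H a) = H p ∧ S i (H b) = H p' := by
  classical
  have hQ := finite_cutPoints (S := S) hp
  set Q := cutPoints S H with hQdef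
  -- For `x ∉ Q`, the set `R x` labels the interval between neighbouring cut points that contains
  -- `x`. No arc `S i '' γ` begins or ends inside such an interval, so one branch `ι (R x)` serves
  -- all of it.
  let R : ℝ → Set ℝ := fun x => {q ∈ Q | q < x}
  have hmemArc : ∀ {i s t x}, S i '' γ = H '' Icc s t → s ∈ Q → t ∈ Q → x ∈ Icc (0 : ℝ) 1 →
      (H x ∈ S i '' γ ↔ x ∈ Icc s t) := by
    intro i s t x h hs ht hx
    rw [h]
    refine ⟨?_, fun h => mem_image_of_mem _ h⟩
    rintro ⟨y, hy, hyx⟩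
    rwa [← hp.injOn ⟨hs.1.1.trans hy.1, hy.2.trans ht.1.2⟩ hx hyx]
  have hι : ∀ A : Set ℝ, ∃ i, ∀ x ∈ Icc (0 : ℝ) 1, x ∉ Q → R x = A → H x ∈ S i '' γ := by
    intro A
    by_cases hA : ∃ x ∈ Icc (0 : ℝ) 1, x ∉ Q ∧ R x = A
    · obtain ⟨x, hx, hxQ, rfl⟩ := hA
      obtain ⟨i, y, hy, hyx⟩ := hS.exists_map_eq (hp.mem x hx)
      obtain ⟨s, hs, t, ht, -, harc⟩ := hp.exists_arc_eq hS i
      have hxst := (hmemArc harc hs ht hx).1 ⟨y, hy, hyx⟩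
      refine ⟨i, fun x' hx' hxQ' hR => (hmemArc harc hs ht hx').2 ⟨?_, ?_⟩⟩
      · have h1 : s ∈ R x := ⟨hs, lt_of_le_of_ne hxst.1 fun h => hxQ (h ▸ hs)⟩
        rw [← hR] at h1
        exact h1.2.le
      · by_contra hlt
        have h1 : t ∈ R x' := ⟨ht, not_le.1 hlt⟩
        rw [hR] at h1
        exact h1.2.not_ge hxst.2
    · obtain ⟨i, -⟩ := hS.exists_map_eq (hp.mem 0 (by simp))
      exact ⟨i, fun x hx hxQ h => (hA ⟨x, hx, hxQ, h⟩).elim⟩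
  choose ι hι using hι
  have hT : ∀ x, ∃ y, x ∈ Icc (0 : ℝ) 1 → y ∈ Icc (0 : ℝ) 1 ∧ ∃ i, S i (H y) = H x ∧
      (x ∉ Q → i = ι (R x)) := by
    intro x
    by_cases hx : x ∈ Icc (0 : ℝ) 1
    · obtain ⟨i, hi, hiQ⟩ : ∃ i, H x ∈ S i '' γ ∧ (x ∉ Q → i = ι (R x)) := by
        by_cases hxQ : x ∈ Q
        · obtain ⟨i, y, hy, h⟩ := hS.exists_map_eq (hp.mem x hx)
          exact ⟨i, ⟨y, hy, h⟩, fun h => (h hxQ).elim⟩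
        · exact ⟨ι (R x), hι _ x hx hxQ rfl, fun _ => rfl⟩
      obtain ⟨y, hy, hyx⟩ := hi
      exact ⟨τ y, fun _ => ⟨hp.inv_mem y hy, i, by rw [hp.right_inv y hy, hyx], hiQ⟩⟩
    · exact ⟨0, fun h => (hx h).elim⟩
  choose T hT using hT
  -- All branches are allowed here, not only the one chosen by `T`: the two gaps that meet at a cut
  -- point may use different branches.
  let B : Set ℝ := {y | y ∈ Icc (0 : ℝ) 1 ∧ ∃ i, ∃ q ∈ Q, S i (H y) = H q}
  have hB : B.Finite := by
    have h1 : (⋃ i, {y | y ∈ Icc (0 : ℝ) 1 ∧ S i (H y) ∈ H '' Q}).Finite := by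
      refine finite_iUnion fun i => Set.Finite.of_finite_image ((hQ.image H).subset ?_)
        (f := fun y => S i (H y)) ?_
      · rintro _ ⟨y, hy, rfl⟩
        exact hy.2
      · intro y hy y' hy' h
        exact hp.injOn hy.1 hy'.1 (hS.inj i h)
    refine h1.subset ?_
    rintro y ⟨hy, i, q, hq, h⟩
    exact mem_iUnion.2 ⟨i, hy, q, hq, h.symm⟩
  have hfin : (Q ∪ ⋃ y ∈ B, range fun k => T^[k] y).Finite := by
    refine hQ.union (hB.biUnion fun y hy => ?_)
    obtain ⟨hy, i, q, hq, h⟩ := hy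
    refine finite_backward_orbit hp hS hpar hseg (fun x hx => ?_) hy ⟨[i], q, hq, h⟩
    obtain ⟨h1, i, h2, -⟩ := hT x hx
    exact ⟨h1, i, h2⟩
  have hsub : ∀ x ∈ (Q ∪ ⋃ y ∈ B, range fun k => T^[k] y), x ∈ Icc (0 : ℝ) 1 := by
    rintro x (hx | hx)
    · exact hx.1
    · simp only [mem_iUnion, mem_range] at hx
      obtain ⟨y, hy, k, rfl⟩ := hx
      induction k with
      | zero => exact hy.1
      | succ k ih =>
        rw [Function.iterate_succ_apply']
        exact (hT _ ih).1
  have hcl : ∀ p ∈ (Q ∪ ⋃ y ∈ B, range fun k => T^[k] y), ∀ i, H p ∈ S i '' γ →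
      (p ∉ Q → i = ι (R p)) →
      ∃ a ∈ (Q ∪ ⋃ y ∈ B, range fun k => T^[k] y), S i (H a) = H p := by
    intro p hpP i hi hiQ
    obtain ⟨y, hy, hyp⟩ := hi
    have hτ : S i (H (τ y)) = H p := by rw [hp.right_inv y hy, hyp]
    refine ⟨τ y, Or.inr ?_, hτ⟩
    simp only [mem_iUnion, mem_range]
    by_cases hpQ : p ∈ Q
    · exact ⟨τ y, ⟨hp.inv_mem y hy, i, p, hpQ, hτ⟩, 0, rfl⟩
    · rcases hpP with h | h
      · exact (hpQ h).elim
      · obtain ⟨h1, i', h2, h3⟩ := hT p (hsub p (Or.inr h))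
        rw [h3 hpQ, ← hiQ hpQ, ← hτ] at h2
        have h4 := hp.injOn h1 (hp.inv_mem y hy) (hS.inj i h2)
        simp only [mem_iUnion, mem_range] at h
        obtain ⟨z, hz, k, rfl⟩ := h
        exact ⟨z, hz, k + 1, by rw [Function.iterate_succ_apply', h4]⟩
  refine ⟨hfin.toFinset, ?_, ?_, ?_, ?_⟩
  · simp [hQdef, mem_cutPoints_of_mem_pair hp hS]
  · simp [hQdef, mem_cutPoints_of_mem_pair hp hS]
  · intro x hx
    exact hsub x (hfin.mem_toFinset.1 hx)
  · simp only [hfin.mem_toFinset]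
    intro p hpP p' hpP' hlt hgap
    -- An interior point selects the branch of the gap. An end of the gap that is not a cut point
    -- has the same label as `x`, so its preimage under this branch is its image under `T`; at a cut
    -- point the preimage is in `B`.
    obtain ⟨x, hpx, hxp⟩ := exists_between hlt
    have hxQ : x ∉ Q := fun h => hgap x (Or.inl h) ⟨hpx, hxp⟩
    have hp01 := hsub p hpP
    have hp'01 := hsub p' hpP'
    have hx01 : x ∈ Icc (0 : ℝ) 1 := ⟨hp01.1.trans hpx.le, hxp.le.trans hp'01.2⟩
    have hix := hι (R x) x hx01 hxQ rfl
    obtain ⟨s, hs, t, ht, -, harc⟩ := hp.exists_arc_eq hS (ι (R x))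
    have hxst := (hmemArc harc hs ht hx01).1 hix
    have hsp : s ≤ p := not_lt.1 fun h => hgap s (Or.inl hs) ⟨h, hxst.1.trans_lt hxp⟩
    have htp : p' ≤ t := not_lt.1 fun h => hgap t (Or.inl ht) ⟨hpx.trans_le hxst.2, h⟩
    obtain ⟨a, ha, hap⟩ := hcl p hpP (ι (R x))
      ((hmemArc harc hs ht hp01).2 ⟨hsp, hlt.le.trans htp⟩) (fun hpQ => by
        congr 1
        ext q
        refine and_congr_right fun hq => ⟨fun h => ?_, fun h => h.trans hpx⟩
        refine lt_of_le_of_ne (not_lt.1 fun h' => hgap q (Or.inl hq) ⟨h', h.trans hxp⟩) ?_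
        rintro rfl
        exact hpQ hq)
    obtain ⟨b, hb, hbp⟩ := hcl p' hpP' (ι (R x))
      ((hmemArc harc hs ht hp'01).2 ⟨hsp.trans hlt.le, htp⟩) (fun hpQ => by
        congr 1
        ext q
        refine and_congr_right fun hq => ⟨fun h => h.trans hxp, fun h => ?_⟩
        exact lt_of_le_of_lt (not_lt.1 fun h' => hgap q (Or.inl hq) ⟨h', h⟩) hpx)
    exact ⟨ι (R x), a, ha, b, hb, hap, hbp⟩

end

/-! ### Assembling the multizipper -/

theorem exists_gap_of_mem_Icc {p : ℕ → ℝ} {a l : ℕ} (hl : 0 < l) {x : ℝ}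
    (hx : x ∈ Icc (p a) (p (a + l))) : ∃ k < l, x ∈ Icc (p (a + k)) (p (a + k + 1)) := by
  induction l, hl using Nat.le_induction with
  | base => exact ⟨0, one_pos, hx⟩
  | succ l hl ih =>
    rcases le_total x (p (a + l)) with h | h
    · obtain ⟨k, hk, hkx⟩ := ih ⟨hx.1, h⟩
      exact ⟨k, by omega, hkx⟩
    · exact ⟨l, by omega, h, hx.2⟩

/-- A finite indexing of the pairs `a < b ≤ N`. -/
theorem exists_index_pairs (N : ℕ) : ∃ (n : ℕ) (lo hi : Fin n → ℕ), (∀ u, lo u < hi u) ∧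
    (∀ u, hi u ≤ N) ∧ ∀ a b, a < b → b ≤ N → ∃ u, lo u = a ∧ hi u = b := by
  let U := {q : Fin (N + 1) × Fin (N + 1) // q.1 < q.2}
  let e : U ≃ Fin (Fintype.card U) := Fintype.equivFin U
  refine ⟨Fintype.card U, fun u => (e.symm u).1.1, fun u => (e.symm u).1.2, fun u => (e.symm u).2,
    fun u => Nat.le_of_lt_succ (e.symm u).1.2.2, fun a b hab hb => ?_⟩
  exact ⟨e ⟨(⟨a, by omega⟩, ⟨b, by omega⟩), hab⟩, by simp, by simp⟩

section
variable {m : ℕ} {S : Fin m → Plane →ᵃ[ℝ] Plane} {γ : Set Plane} {c : ℝ}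
  {H : ℝ → Plane} {τ : Plane → ℝ}

theorem IsParam.isJordanArcFrom (hp : IsParam γ H τ) {a b : ℝ} (ha : 0 ≤ a) (hab : a < b)
    (hb : b ≤ 1) : IsJordanArcFrom (H '' Icc a b) (H a) (H b) := by
  have hmem : ∀ s : unitInterval, a + s * (b - a) ∈ Icc a b := fun s =>
    ⟨by nlinarith [s.2.1], by nlinarith [s.2.2]⟩
  refine ⟨fun s => H (a + s * (b - a)), ?_, ?_, by simp, by simp, ?_⟩
  · exact hp.cont.comp (by fun_prop)
  · intro s t hst
    have h := hp.injOn (Icc_subset_Icc ha hb (hmem s)) (Icc_subset_Icc ha hb (hmem t)) hst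
    have h1 : (b - a) ≠ 0 := by linarith
    exact Subtype.ext (mul_right_cancel₀ h1 (add_left_cancel h))
  · ext y
    constructor
    · rintro ⟨s, rfl⟩
      exact mem_image_of_mem _ (hmem s)
    · rintro ⟨t, ht, rfl⟩
      have h1 : 0 < b - a := by linarith
      refine ⟨⟨(t - a) / (b - a), div_nonneg (by linarith [ht.1]) h1.le, ?_⟩, ?_⟩
      · rw [div_le_one h1]
        linarith [ht.2]
      · simp only
        rw [div_mul_cancel₀ _ h1.ne']
        simp

/-- The Markov partition written as an increasing sequence. -/
theorem exists_markov_sequence (hp : IsParam γ H τ) (hS : IsSystem S γ c)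
    (hpar : ¬ IsParabolicSegment γ) (hseg : ¬ IsStraightSegment γ) :
    ∃ (N : ℕ) (p : ℕ → ℝ), 0 < N ∧ p 0 = 0 ∧ p N = 1 ∧
      (∀ i j, i < j → j ≤ N → p i < p j) ∧ (∀ j, j ≤ N → p j ∈ Icc (0 : ℝ) 1) ∧
      ∀ g < N, ∃ i, ∃ a ≤ N, ∃ b ≤ N, S i (H (p a)) = H (p g) ∧ S i (H (p b)) = H (p (g + 1)) := by
  obtain ⟨P, h0, h1, hP, hgap⟩ := exists_markov_partition hp hS hpar hseg
  have hcard : 1 < P.card := Finset.one_lt_card.2 ⟨0, h0, 1, h1, zero_ne_one⟩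
  obtain ⟨N, hN⟩ : ∃ N, P.card = N + 1 := ⟨P.card - 1, by omega⟩
  let e := P.orderEmbOfFin hN
  let p : ℕ → ℝ := fun j => if h : j < N + 1 then e ⟨j, h⟩ else 1
  have hpe : ∀ j (h : j < N + 1), p j = e ⟨j, h⟩ := fun j h => dif_pos h
  have hmem : ∀ j, j ≤ N → p j ∈ P := fun j hj => by
    rw [hpe j (by omega)]
    exact Finset.orderEmbOfFin_mem P hN _
  have hlt : ∀ i j, i < j → j ≤ N → p i < p j := fun i j hij hj => by
    rw [hpe i (by omega), hpe j (by omega)]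
    exact e.strictMono hij
  have hsurj : ∀ x ∈ P, ∃ j ≤ N, p j = x := by
    intro x hx
    have : x ∈ range e := by
      rw [Finset.range_orderEmbOfFin]
      exact hx
    obtain ⟨j, rfl⟩ := this
    exact ⟨j, by omega, hpe j j.2⟩
  have hle : ∀ i j, i ≤ j → j ≤ N → p i ≤ p j := fun i j hij hj => by
    rcases hij.lt_or_eq with h | rfl
    · exact (hlt i j h hj).le
    · exact le_rfl
  refine ⟨N, p, by omega, ?_, ?_, hlt, fun j hj => hP _ (hmem j hj), fun g hg => ?_⟩
  · obtain ⟨j, hj, hj0⟩ := hsurj 0 h0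
    exact le_antisymm ((hle 0 j (by omega) hj).trans hj0.le) (hP _ (hmem 0 (by omega))).1
  · obtain ⟨j, hj, hj1⟩ := hsurj 1 h1
    exact le_antisymm (hP _ (hmem N le_rfl)).2 (hj1.ge.trans (hle j N hj le_rfl))
  · obtain ⟨i, a, ha, b, hb, h2, h3⟩ := hgap (p g) (hmem g hg.le) (p (g + 1)) (hmem _ hg)
      (hlt g (g + 1) (by omega) hg) (by
        rintro x hx ⟨hgx, hxg⟩
        obtain ⟨j, hj, rfl⟩ := hsurj x hx
        rcases le_or_gt j g with h | h
        · exact (hle j g h hg.le).not_gt hgx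
        · exact (hle (g + 1) j h hj).not_gt hxg)
    obtain ⟨ja, hja, rfl⟩ := hsurj a ha
    obtain ⟨jb, hjb, rfl⟩ := hsurj b hb
    exact ⟨i, ja, hja, jb, hjb, h2, h3⟩

/-- A vertex is a pair of partition points and its nodes are all partition points from one to the
other. Taking every pair as a vertex makes the system closed: the subarc that an `S i` takes onto a
gap is again a component, and the pair of extreme points gives `γ`. -/
theorem exists_multizipper (hp : IsParam γ H τ) (hS : IsSystem S γ c)
    (hcon : ∀ i, IsContractingAffine (S i))
    (hpar : ¬ IsParabolicSegment γ) (hseg : ¬ IsStraightSegment γ) :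
    ∃ (n : ℕ) (Z : SelfAffineMultizipper n) (K : Fin n → Set Plane),
      Z.IsAttractor K ∧ Z.IsJordan K ∧ ∃ u, K u = γ := by
  obtain ⟨N, p, hN, hp0, hpN, hlt, hp01, hlink⟩ := exists_markov_sequence hp hS hpar hseg
  obtain ⟨n, lo, hi, hlohi, hhi, hvert⟩ := exists_index_pairs N
  have : Nonempty (Fin m) := ⟨(hlink 0 hN).choose⟩
  choose! idx a ha b hb hia hib using hlink
  have hle : ∀ i j, i ≤ j → j ≤ N → p i ≤ p j := fun i j hij hj => by
    rcases hij.lt_or_eq with h | rfl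
    · exact (hlt i j h hj).le
    · exact le_rfl
  have hinj : ∀ i j, i ≤ N → j ≤ N → H (p i) = H (p j) → i = j := by
    intro i j hi hj h
    have := hp.injOn (hp01 i hi) (hp01 j hj) h
    rcases lt_trichotomy i j with h1 | h1 | h1
    · exact absurd this (hlt i j h1 hj).ne
    · exact h1
    · exact absurd this (hlt j i h1 hi).ne'
  have hab : ∀ g < N, a g ≠ b g := by
    intro g hg h
    have h1 := hia g hg
    rw [h, hib g hg] at h1
    have := hinj _ _ hg hg.le h1
    omega
  have htar : ∀ g, ∃ v, g < N → lo v = min (a g) (b g) ∧ hi v = max (a g) (b g) := by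
    intro g
    by_cases hg : g < N
    · obtain ⟨v, hv⟩ := hvert _ _ (min_lt_max.2 (hab g hg)) (max_le (ha g hg) (hb g hg))
      exact ⟨v, fun _ => hv⟩
    · obtain ⟨v, -⟩ := hvert 0 N hN le_rfl
      exact ⟨v, fun h => (hg h).elim⟩
  choose tar htar using htar
  have hg : ∀ u (k : Fin (hi u - lo u)), lo u + k < N := fun u k => by
    have := hhi u
    omega
  let Z : SelfAffineMultizipper n :=
    { len := fun u => hi u - lo u
      len_pos := fun u => Nat.sub_pos_of_lt (hlohi u)
      node := fun u l => H (p (lo u + l))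
      target := fun u k => tar (lo u + k)
      -- Nodes are listed by increasing parameter, so the signature records whether the map reverses
      -- the parameter.
      reversed := fun u k => decide (b (lo u + k) < a (lo u + k))
      map := fun u k => S (idx (lo u + k))
      map_injective := fun u k => hS.inj _
      map_contracting := fun u k => hcon _
      map_first := fun u k => by
        obtain ⟨h1, -⟩ := htar _ (hg u k)
        simp only [Fin.val_zero, add_zero, h1]
        by_cases h : b (lo u + k) < a (lo u + k)
        · simp only [h, decide_true, if_true, min_eq_right h.le]
          exact hib _ (hg u k)
        · simp only [h, decide_false, Bool.false_eq_true, if_false, min_eq_left (not_lt.1 h)]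
          exact hia _ (hg u k)
      map_last := fun u k => by
        obtain ⟨-, h2⟩ := htar _ (hg u k)
        simp only [Fin.val_last]
        rw [Nat.add_sub_of_le (hlohi _).le, h2]
        by_cases h : b (lo u + k) < a (lo u + k)
        · simp only [h, decide_true, if_true, max_eq_left h.le]
          exact hia _ (hg u k)
        · simp only [h, decide_false, Bool.false_eq_true, if_false, max_eq_right (not_lt.1 h)]
          exact hib _ (hg u k) }
  let K : Fin n → Set Plane := fun u => H '' Icc (p (lo u)) (p (hi u))
  have hpiece : ∀ u (k : Fin (Z.len u)),
      Z.piece K u k = H '' Icc (p (lo u + k)) (p (lo u + k + 1)) := by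
    intro u k
    have hgk := hg u k
    obtain ⟨h1, h2⟩ := htar _ hgk
    have hK : K (tar (lo u + k)) = H '' uIcc (p (a (lo u + k))) (p (b (lo u + k))) := by
      simp only [K, h1, h2]
      have h3 := ha _ hgk
      have h4 := hb _ hgk
      rcases le_total (a (lo u + k)) (b (lo u + k)) with h | h
      · rw [min_eq_left h, max_eq_right h, uIcc_of_le (hle _ _ h h4)]
      · rw [min_eq_right h, max_eq_left h, uIcc_of_ge (hle _ _ h h3)]
    have him := hp.image_word hS [idx (lo u + k)] (hp01 _ (ha _ hgk)) (hp01 _ (hb _ hgk))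
    simp only [word_cons, word_nil, hia _ hgk, hib _ hgk, hp.left_inv _ (hp01 _ hgk.le),
      hp.left_inv _ (hp01 _ hgk)] at him
    rw [uIcc_of_le (a := p (lo u + k)) (hlt _ _ (Nat.lt_succ_self _) hgk).le] at him
    change S (idx (lo u + k)) '' K (tar (lo u + k)) = _
    rw [hK]
    exact him
  have hIcc : ∀ {i j x}, j ≤ N → x ∈ Icc (p i) (p j) → i ≤ N → x ∈ Icc (0 : ℝ) 1 :=
    fun hj hx hi => ⟨(hp01 _ hi).1.trans hx.1, hx.2.trans (hp01 _ hj).2⟩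
  refine ⟨n, Z, K, fun u => ⟨?_, isCompact_Icc.image hp.cont, ?_⟩, fun u => ⟨?_, ?_, ?_⟩, ?_⟩
  · exact (nonempty_Icc.2 (hlt _ _ (hlohi u) (hhi u)).le).image _
  · simp only [hpiece]
    rw [← image_iUnion]
    refine congrArg (H '' ·) (Subset.antisymm (fun x hx => ?_) (iUnion_subset fun k => ?_))
    · obtain ⟨k, hk, hkx⟩ := exists_gap_of_mem_Icc (p := p) (a := lo u)
        (Nat.sub_pos_of_lt (hlohi u)) (by rwa [Nat.add_sub_of_le (hlohi u).le])
      exact mem_iUnion.2 ⟨⟨k, hk⟩, hkx⟩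
    · have hk : (k : ℕ) < hi u - lo u := k.2
      have := hhi u
      exact Icc_subset_Icc (hle _ _ (by omega) (by omega)) (hle _ _ (by omega) (hhi u))
  · have h1 : Z.node u 0 = H (p (lo u)) := rfl
    have h2 : Z.node u (Fin.last _) = H (p (hi u)) := by
      change H (p (lo u + (hi u - lo u))) = _
      rw [Nat.add_sub_of_le (hlohi u).le]
    rw [h1, h2]
    have := hlohi u
    have := hhi u
    exact hp.isJordanArcFrom (hp01 _ (by omega)).1 (hlt _ _ (hlohi u) (hhi u)) (hp01 _ (hhi u)).2
  · intro i j hij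
    have hj := hg u j
    have hj' : lo u + (i : ℕ) + 1 = lo u + j := by omega
    rw [hpiece, hpiece, hj']
    have hnode : Z.node u j.castSucc = H (p (lo u + j)) := rfl
    rw [hnode]
    refine Subset.antisymm ?_ ?_
    · rintro _ ⟨⟨x, hx, rfl⟩, ⟨y, hy, hyx⟩⟩
      have hx01 := hIcc hj.le hx (by omega)
      have hxy := hp.injOn (hIcc hj hy hj.le) hx01 hyx
      subst hxy
      rw [mem_singleton_iff, le_antisymm hx.2 hy.1]
    · rw [singleton_subset_iff]
      exact ⟨⟨_, ⟨hle _ _ (by omega) hj.le, le_rfl⟩, rfl⟩,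
        ⟨_, ⟨le_rfl, hle _ _ (by omega) hj⟩, rfl⟩⟩
  · intro i j hij
    have hj := hg u j
    rw [hpiece, hpiece, Set.disjoint_left]
    rintro _ ⟨x, hx, rfl⟩ ⟨y, hy, hyx⟩
    have hx01 := hIcc (by omega) hx (by omega)
    have hxy := hp.injOn (hIcc hj hy hj.le) hx01 hyx
    subst hxy
    exact ((hlt (lo u + i + 1) (lo u + j) (by omega) hj.le).trans_le hy.1).not_ge hx.2
  · obtain ⟨u, hu0, huN⟩ := hvert 0 N hN le_rfl
    refine ⟨u, ?_⟩
    simp only [K, hu0, huN, hp0, hpN]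
    exact hp.image_eq

end
end SelfAffineArc

theorem theorem4 {m : ℕ} (S : Fin m → Plane →ᵃ[ℝ] Plane)
    (hS_contracting : ∀ i, IsContractingAffine (S i))
    (hS_nondegenerate : ∀ i, Function.Injective (S i))
    (γ : Set Plane) (hγ : IsJordanArc γ) (hSγ : IsAttractor S γ)
    (hγ_parabola : ¬ IsParabolicSegment γ) (hγ_segment : ¬ IsStraightSegment γ) :
    ∃ (n : ℕ) (Z : SelfAffineMultizipper n) (K : Fin n → Set Plane),
      Z.IsAttractor K ∧ Z.IsJordan K ∧ ∃ u, K u = γ := by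
  obtain ⟨H, τ, hp⟩ := SelfAffineArc.exists_isParam hγ
  obtain ⟨c, hS⟩ := SelfAffineArc.exists_isSystem hS_contracting hS_nondegenerate hSγ
  exact SelfAffineArc.exists_multizipper hp hS hS_contracting hγ_parabola hγ_segment
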